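/- Let $X$ be a smooth real (finite-dimensional) manifold equipped with three symplectic forms $\omega_I,\omega_J,\omega_K$. View a symplectic form $\omega$ as the isomorphism $TX\to T^*X$, $v\mapsto\omega(v,\cdot)$, and view a bundle map $g:TX\to T^*X$ as the field of bilinear forms $g(v,w)=(g(v))(w)$. A *pseudo-hyper-Kähler structure* on $X$ with respect to a pseudo-Riemannian metric $g$ (a smooth field of nondegenerate symmetric bilinear forms on $TX$, of arbitrary signature) is a smooth action of the algebra of quaternions $\mathbb H$ on $TX$ by real-linear bundle endomorphisms which is compatible with the metric, i.e. $g(qv,w)=g(v,\bar q w)$ for all $q\in\mathbb H$ and all tangent vectors $v,w$ at a common point, and which is parallel with respect to the Levi-Civita connection of $g$. If $g$ is moreover positive definite, $X$ with this structure is called *hyper-Kähler*. (a) Assume that $$\omega_I^{-1}\circ\omega_J=-\omega_J^{-1}\circ\omega_I,\qquad \omega_J^{-1}\circ\omega_K=-\omega_K^{-1}\circ\omega_J,\qquad \omega_K^{-1}\circ\omega_I=-\omega_I^{-1}\circ\omega_K .$$ Then the isomorphism $g:=\omega_I\circ\omega_J^{-1}\circ\omega_K:TX\to T^*X$ is a (possibly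 indefinite) pseudo-Riemannian metric on $X$, and $X$ is pseudo-hyper-Kähler with respect to $g$: there is an action of $\mathbb H$ on $TX$ as above, with the quaternion units $i,j,k$ acting by endomorphisms $I,J,K$ that satisfy $\omega_I(v,w)=g(Iv,w)$, $\omega_J(v,w)=g(Jv,w)$ and $\omega_K(v,w)=g(Kv,w)$. (b) Consequently, if moreover $g$ is positive definite, then $X$, with the metric $g$ and this action, is hyper-Kähler. -/

import Mathlib

open scoped Manifold ContDiff Bundle Quaternion

noncomputable section

namespace HyperKahler

variable (E : Type*) [NormedAddCommGroup E] [NormedSpace ℝ E]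
  (X : Type*) [TopologicalSpace X] [ChartedSpace E X]

/-- A field of bilinear forms on the tangent spaces of `X`, that is, a map `TX → T*X` over the
identity of `X`: the form `b` sends `v` to `b(v, ·)`. -/
abbrev BilinField : Type _ :=
  ∀ x : X, TangentSpace 𝓘(ℝ, E) x →L[ℝ] TangentSpace 𝓘(ℝ, E) x →L[ℝ] ℝ

/-- A field of endomorphisms of the tangent spaces of `X`. -/
abbrev EndField : Type _ :=
  ∀ x : X, TangentSpace 𝓘(ℝ, E) x →L[ℝ] TangentSpace 𝓘(ℝ, E) x

/-- A fibrewise action of the algebra of quaternions on the tangent bundle of `X`: a unital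
homomorphism of real algebras from `ℍ` to the endomorphisms of each tangent space. -/
abbrev QuaternionAction : Type _ :=
  ∀ x : X, ℍ[ℝ] →ₐ[ℝ] (TangentSpace 𝓘(ℝ, E) x →L[ℝ] TangentSpace 𝓘(ℝ, E) x)

variable {E X}

section Smooth

variable [IsManifold 𝓘(ℝ, E) ∞ X]

/-- `b` is a smooth section of the bundle `Hom(TX, Hom(TX, ℝ))`. -/
def BilinField.IsSmooth (b : BilinField E X) : Prop :=
  ContMDiff 𝓘(ℝ, E) (𝓘(ℝ, E).prod 𝓘(ℝ, E →L[ℝ] E →L[ℝ] ℝ)) ∞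
    (fun x ↦ Bundle.TotalSpace.mk' (E →L[ℝ] E →L[ℝ] ℝ)
      (E := fun x : X ↦ TangentSpace 𝓘(ℝ, E) x →L[ℝ] TangentSpace 𝓘(ℝ, E) x →L[ℝ] ℝ) x (b x))

/-- `A` is a smooth section of the bundle `Hom(TX, TX)`. -/
def EndField.IsSmooth (A : EndField E X) : Prop :=
  ContMDiff 𝓘(ℝ, E) (𝓘(ℝ, E).prod 𝓘(ℝ, E →L[ℝ] E)) ∞
    (fun x ↦ Bundle.TotalSpace.mk' (E →L[ℝ] E)
      (E := fun x : X ↦ TangentSpace 𝓘(ℝ, E) x →L[ℝ] TangentSpace 𝓘(ℝ, E) x) x (A x))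

end Smooth

/-- `b x v = 0` only for `v = 0`. -/
def BilinField.IsNondegenerate (b : BilinField E X) : Prop :=
  ∀ (x : X) (v : TangentSpace 𝓘(ℝ, E) x), (∀ w, b x v w = 0) → v = 0

/-- The value at `x` of the exterior derivative `dΩ(U, V, W)` of a `2`-form `Ω` on three vector
fields, as given by
`U Ω(V, W) - V Ω(U, W) + W Ω(U, V) - Ω([U, V], W) + Ω([U, W], V) - Ω([V, W], U)`. -/
def extDerivTwoForm (Ω : BilinField E X) (U V W : ∀ x : X, TangentSpace 𝓘(ℝ, E) x) (x : X) : ℝ :=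
  d% (fun y ↦ Ω y (V y) (W y)) x (U x)
    - d% (fun y ↦ Ω y (U y) (W y)) x (V x)
    + d% (fun y ↦ Ω y (U y) (V y)) x (W x)
    - Ω x (VectorField.mlieBracket 𝓘(ℝ, E) U V x) (W x)
    + Ω x (VectorField.mlieBracket 𝓘(ℝ, E) U W x) (V x)
    - Ω x (VectorField.mlieBracket 𝓘(ℝ, E) V W x) (U x)

variable [IsManifold 𝓘(ℝ, E) ∞ X]

/-- `dΩ = 0`: the exterior derivative vanishes at every point, on all vector fields that are smooth
around that point. -/
def BilinField.IsClosed (Ω : BilinField E X) : Prop :=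
  ∀ (x : X) (U V W : ∀ x : X, TangentSpace 𝓘(ℝ, E) x),
    CMDiffAt ∞ (T% U) x → CMDiffAt ∞ (T% V) x → CMDiffAt ∞ (T% W) x →
      extDerivTwoForm Ω U V W x = 0

variable (E X) in
/-- A symplectic form: a smooth, alternating, nondegenerate, closed `2`-form. -/
structure SymplecticForm where
  form : BilinField E X
  smooth : form.IsSmooth
  alternating : ∀ (x : X) (v : TangentSpace 𝓘(ℝ, E) x), form x v v = 0
  nondegenerate : form.IsNondegenerate
  closed : form.IsClosed

/-- A pseudo-Riemannian metric: a smooth field of nondegenerate symmetric bilinear forms, of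
arbitrary signature. -/
structure IsPseudoRiemannianMetric (g : BilinField E X) : Prop where
  smooth : g.IsSmooth
  symm : ∀ (x : X) (v w : TangentSpace 𝓘(ℝ, E) x), g x v w = g x w v
  nondegenerate : g.IsNondegenerate

/-- `g` is positive definite on every tangent space. -/
def IsPositiveDefinite (g : BilinField E X) : Prop :=
  ∀ (x : X) (v : TangentSpace 𝓘(ℝ, E) x), v ≠ 0 → 0 < g x v v

variable [FiniteDimensional ℝ E]

theorem SymplecticForm.bijective (Ω : SymplecticForm E X) (x : X) :
    Function.Bijective (Ω.form x) := by
  have inj : Function.Injective (Ω.form x) := by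
    refine (injective_iff_map_eq_zero (Ω.form x)).2 fun v hv ↦ Ω.nondegenerate x v fun w ↦ ?_
    rw [hv]; rfl
  have hrank : Module.finrank ℝ (E →L[ℝ] ℝ) = Module.finrank ℝ E := by
    rw [← (LinearMap.toContinuousLinearMap (𝕜 := ℝ) (E := E) (F' := ℝ)).finrank_eq]
    exact Subspace.dual_finrank_eq
  have key : ∀ f : E →L[ℝ] (E →L[ℝ] ℝ), Function.Injective f → Function.Bijective f := by
    intro f hf
    exact ⟨hf, (LinearMap.injective_iff_surjective_of_finrank_eq_finrank
      (f := (f : E →ₗ[ℝ] (E →L[ℝ] ℝ))) hrank.symm).1 hf⟩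
  exact key (Ω.form x) inj

/-- The isomorphism `T_xX → T_x*X`, `v ↦ Ω(v, ·)`, given by a symplectic form `Ω`. -/
def SymplecticForm.iso (Ω : SymplecticForm E X) (x : X) :
    TangentSpace 𝓘(ℝ, E) x ≃L[ℝ] (TangentSpace 𝓘(ℝ, E) x →L[ℝ] ℝ) :=
  haveI : T2Space (TangentSpace 𝓘(ℝ, E) x) := inferInstanceAs (T2Space E)
  haveI : FiniteDimensional ℝ (TangentSpace 𝓘(ℝ, E) x) := inferInstanceAs (FiniteDimensional ℝ E)
  (LinearEquiv.ofBijective (Ω.form x : TangentSpace 𝓘(ℝ, E) x →ₗ[ℝ] _)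
    (Ω.bijective x)).toContinuousLinearEquiv

/-- The endomorphism `Ω₁⁻¹ ∘ Ω₂` of `TX`. -/
def invComp (Ω₁ Ω₂ : SymplecticForm E X) : EndField E X := fun x ↦
  ((Ω₁.iso x).symm : (TangentSpace 𝓘(ℝ, E) x →L[ℝ] ℝ) →L[ℝ] TangentSpace 𝓘(ℝ, E) x) ∘L
    (Ω₂.iso x : TangentSpace 𝓘(ℝ, E) x →L[ℝ] (TangentSpace 𝓘(ℝ, E) x →L[ℝ] ℝ))

/-- The map `Ω₁ ∘ Ω₂⁻¹ ∘ Ω₃ : TX → T*X`, as a field of bilinear forms. -/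
def tripleComp (Ω₁ Ω₂ Ω₃ : SymplecticForm E X) : BilinField E X := fun x ↦
  (Ω₁.iso x : TangentSpace 𝓘(ℝ, E) x →L[ℝ] (TangentSpace 𝓘(ℝ, E) x →L[ℝ] ℝ)) ∘L invComp Ω₂ Ω₃ x

/-- `D` is the Levi-Civita connection of `g`: it is torsion-free, and compatible with `g`, that is,
`d(g(V, W))(u) = g(D_u V, W) + g(V, D_u W)`. (The value `D_u V` is `D V x u` for `u ∈ T_xX`. These
two properties determine `D V x` for every vector field `V` that is differentiable at `x`; on other
vector fields a `CovariantDerivative` takes unspecified values.) -/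
structure IsLeviCivita (g : BilinField E X)
    (D : CovariantDerivative 𝓘(ℝ, E) E (TangentSpace 𝓘(ℝ, E) : X → Type _)) : Prop where
  torsion_free : ∀ (x : X) (V W : ∀ x : X, TangentSpace 𝓘(ℝ, E) x),
    MDiffAt (T% V) x → MDiffAt (T% W) x →
      D W x (V x) - D V x (W x) = VectorField.mlieBracket 𝓘(ℝ, E) V W x
  metric : ∀ (x : X) (V W : ∀ x : X, TangentSpace 𝓘(ℝ, E) x),
    MDiffAt (T% V) x → MDiffAt (T% W) x → ∀ u : TangentSpace 𝓘(ℝ, E) x,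
      d% (fun y ↦ g y (V y) (W y)) x u = g x (D V x u) (W x) + g x (V x) (D W x u)

/-- The endomorphism field `A` is parallel for the connection `D`: `D_u (A V) = A (D_u V)`. -/
def EndField.IsParallel (A : EndField E X)
    (D : CovariantDerivative 𝓘(ℝ, E) E (TangentSpace 𝓘(ℝ, E) : X → Type _)) : Prop :=
  ∀ (x : X) (V : ∀ x : X, TangentSpace 𝓘(ℝ, E) x), MDiffAt (T% V) x →
    ∀ u : TangentSpace 𝓘(ℝ, E) x, D (fun y ↦ A y (V y)) x u = A x (D V x u)

/-- `X` with the pseudo-Riemannian metric `g` and the action `ρ` of the quaternions on `TX` is a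
pseudo-hyper-Kähler manifold: the action is smooth, every imaginary quaternion acts by
`g`-skew-symmetric endomorphisms (equivalently, the adjoint of `ρ q` is `ρ` of the conjugate of
`q`), and the action is parallel with respect to the Levi-Civita connection of `g`. -/
structure IsPseudoHyperKahler (g : BilinField E X) (ρ : QuaternionAction E X) : Prop where
  metric : IsPseudoRiemannianMetric g
  smooth : ∀ q : ℍ[ℝ], EndField.IsSmooth (fun x : X ↦ ρ x q)
  adjoint : ∀ (q : ℍ[ℝ]) (x : X) (v w : TangentSpace 𝓘(ℝ, E) x),
    g x (ρ x q v) w = g x v (ρ x (star q) w)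
  parallel : ∃ D : CovariantDerivative 𝓘(ℝ, E) E (TangentSpace 𝓘(ℝ, E) : X → Type _),
    IsLeviCivita g D ∧ ∀ q : ℍ[ℝ], EndField.IsParallel (fun x : X ↦ ρ x q) D

/-- A hyper-Kähler manifold: a pseudo-hyper-Kähler manifold whose metric is positive definite. -/
structure IsHyperKahler (g : BilinField E X) (ρ : QuaternionAction E X) : Prop where
  pseudo : IsPseudoHyperKahler g ρ
  positive : IsPositiveDefinite g

/-- The `2`-form `(v, w) ↦ g(q v, w)` attached to a quaternion `q`. -/
def kahlerForm (g : BilinField E X) (ρ : QuaternionAction E X) (q : ℍ[ℝ]) : BilinField E X :=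
  fun x ↦ g x ∘L ρ x q

end HyperKahler

end

set_option maxSynthPendingDepth 3

noncomputable section

/-! The hypotheses say that `A = ω_J⁻¹ω_K`, `B = ω_K⁻¹ω_I`, `C = ω_I⁻¹ω_J` each equal minus their
own inverse, so they square to `-1`; cancelling a form against its inverse gives `BA = C` and its
cyclic analogues. Hence `I = -A`, `J = -B`, `K = -C` satisfy the quaternion relations, `g = ω_I A`
is symmetric and nondegenerate, and `ω_I = gI`, `ω_J = gJ`, `ω_K = gK`.

It remains to prove `∇I = ∇J = ∇K = 0` for the Levi-Civita connection. Since `∇` is torsion-free and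
metric, `dω_I` is the cyclic sum of `g((∇_u I)v, w)`. Together with `I² = -1` and skewness,
closedness gives `∇_{Iu} I = (∇_u I) I` (`complexLinear_of_cyclic`, `nablaEnd_complexLinear`), and
likewise for `J` and `K`. Differentiating the quaternion relations links the three derivatives, and
these linear identities at one point leave only the zero solution
(`eq_zero_of_quaternion_derivation`). Integrability of the complex structures is never invoked.

The geometry is computed at each point `x` in the preferred chart at `x`, where tensors become
functions on `E` and `∇` is `d + Γ`. -/

namespace HyperKahler

/-! ### Linear algebra at a point: complex linearity, and the rigidity of quaternion derivations. -/

section PointwiseAlgebra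

/-- If a family `a u` of skew forms with `a u (I v) w = a u v (I w)`, `I² = -1`, has vanishing cyclic
sum, then it is complex linear in the first argument. -/
theorem complexLinear_of_cyclic {V : Type*} [AddCommGroup V] [Module ℝ V] {I : V → V}
    (hI : ∀ v, I (I v) = -v) {a : V → V → V → ℝ}
    (hneg : ∀ u v w, a u (-v) w = -a u v w)
    (hswap : ∀ u v w, a u (I v) w = a u v (I w))
    (hcyc : ∀ u v w, a u v w + a v w u + a w u v = 0) (u v w : V) :
    a (I u) v w = a u (I v) w := by
  have h1 := hcyc (I u) v w
  have h2 := hcyc u (I v) w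
  have h3 := hcyc u v (I w)
  have h4 := hcyc (I u) (I v) (I w)
  simp only [← hswap, hI, hneg] at h1 h2 h3 h4
  -- The combination is `h1 - h2 - h3 + h4`: all terms cancel except `2 a(Iu, v, w) - 2 a(u, Iv,
  -- w)`.
  linarith

/-- Let `i j = k` generate a quaternion algebra in a ring `R` without additive `2`-torsion, and let
`α β γ` satisfy the derivatives of the quaternion relations. If moreover the three families are
complex linear for `i`, `j` and `k` respectively, then they vanish. -/
theorem eq_zero_of_quaternion_derivation {R U : Type*} [Ring R] [IsAddTorsionFree R]
    {i j k : R} {fi fj fk : U → U} {α β γ : U → R}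
    (hii : i * i = -1) (hjj : j * j = -1) (hij : i * j = k) (hji : j * i = -k)
    (hfki : ∀ u, fk (fi u) = fj u)
    (hα : ∀ u, α u * i + i * α u = 0) (hβ : ∀ u, β u * j + j * β u = 0)
    (hγ : ∀ u, γ u = α u * j + i * β u) (hγ' : ∀ u, -γ u = β u * i + j * α u)
    (hαi : ∀ u, α (fi u) = α u * i) (hβj : ∀ u, β (fj u) = β u * j)
    (hγk : ∀ u, γ (fk u) = γ u * k) (u : U) : α u = 0 ∧ β u = 0 ∧ γ u = 0 := by
  -- These rewriting rules bring words in `i`, `j`, `α u`, `β u` to a common form, so that the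
  -- identities below end with `abel`.
  have hii' (x : R) : i * (i * x) = -x := by rw [← mul_assoc, hii, neg_one_mul]
  have hjj' (x : R) : j * (j * x) = -x := by rw [← mul_assoc, hjj, neg_one_mul]
  have hij' : i * j = -(j * i) := by rw [hji, hij, neg_neg]
  have hij'' (x : R) : i * (j * x) = -(j * (i * x)) := by
    rw [← mul_assoc, hij', neg_mul, mul_assoc]
  have hα₁ (u : U) : i * α u = -(α u * i) := eq_neg_of_add_eq_zero_right (hα u)
  have hβ₁ (u : U) : j * β u = -(β u * j) := eq_neg_of_add_eq_zero_right (hβ u)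
  have hα₂ (u : U) (x : R) : i * (α u * x) = -(α u * (i * x)) := by
    rw [← mul_assoc, hα₁, neg_mul, mul_assoc]
  have hβ₂ (u : U) (x : R) : j * (β u * x) = -(β u * (j * x)) := by
    rw [← mul_assoc, hβ₁, neg_mul, mul_assoc]
  have hβ₃ (u : U) : i * β u = -(α u * j) - β u * i - j * α u := by
    have h := hγ' u
    rw [hγ] at h
    rw [eq_sub_iff_add_eq, eq_sub_iff_add_eq, add_assoc, add_comm (j * _), ← h]
    abel
  have hβ₄ (u : U) (x : R) :
      i * (β u * x) = -(α u * (j * x)) - β u * (i * x) - j * (α u * x) := by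
    rw [← mul_assoc, hβ₃]
    simp only [sub_mul, neg_mul, mul_assoc]
  -- Write `{x, y} = xy + yx`. Differentiating `{i, j} = {j, k} = {k, i} = 0` gives `{α, j} = -{β,
  -- i}`, `{β, k} = -{γ, j}`, `{γ, i} = -{α, k}`. Complex linearity adds `{α(Iu), j} = {α i, j} =
  -- {α, k}`, and similarly `{β(Ju), k} = {β, i}` and `{γ(Ku), j} = -{γ, i}`. The four identities
  -- here combine these.
  have hαR (u : U) : α (fi u) * j + j * α (fi u) = -(γ u * i + i * γ u) := by
    rw [hγ, hαi]
    simp only [mul_add, add_mul, sub_mul, neg_mul, mul_sub, mul_assoc, hii, hij', hij'', hα₁, hα₂,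
      hβ₃, hβ₄, mul_neg, neg_neg, mul_one]
    abel
  have hβP (u : U) : β (fj u) * k + k * β (fj u) = -(α u * j + j * α u) := by
    rw [hβj, ← hij]
    simp only [neg_mul, mul_sub, mul_assoc, hjj, hij', hjj',
      hβ₂, hβ₄, mul_neg, neg_neg, mul_one]
    abel
  have hβγ (u : U) : β u * k + k * β u = -(γ u * j + j * γ u) := by
    rw [hγ, ← hij]
    simp only [mul_add, add_mul, sub_mul, neg_mul, mul_sub, mul_assoc, hjj, hij', hjj', hβ₂, hβ₃,
      mul_neg, neg_neg, mul_one]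
    abel
  have hγQ (u : U) : γ (fk u) * j + j * γ (fk u) = -(γ u * i + i * γ u) := by
    rw [hγk, hγ, ← hij]
    simp only [mul_add, add_mul, sub_mul, neg_mul, mul_sub, mul_assoc, hii, hjj, hij', hjj', hij'',
      hα₁, hα₂, hβ₂, hβ₃, hβ₄, mul_neg, neg_neg, mul_one]
    abel
  -- Because `KI = J`, the identities chain up to `{γ(Iu), i} = -{α(u), j}`, so `{α(IIu), j} =
  -- {α(u), j}`. But `α(IIu) = α(u) i² = -α(u)`, so the anticommutator equals its own negative.
  have hR (u : U) : α u * j + j * α u = 0 := by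
    have h1 := hαR (fi u)
    have h2 : γ (fi u) * i + i * γ (fi u) = -(α u * j + j * α u) := by
      rw [← hβP, ← hfki, hβγ, hγQ, neg_neg]
    rw [h2, neg_neg, hαi, hαi, mul_assoc (α u), hii, mul_neg_one, neg_mul, mul_neg, ← neg_add] at h1
    exact self_eq_neg.1 h1.symm
  have hα₀ (u : U) : α u = 0 := by
    have h1 : j * α u = -(α u * j) := eq_neg_of_add_eq_zero_right (hR u)
    -- Both `α(u)` and `α(Iu) = α(u) i` anticommute with `j`; comparing the two gives `2 α(u) ij =
    -- 0`, and `ij` is invertible since `(ij)(ji) = 1`.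
    have h2 : α u * (i * j) = 0 := by
      have h3 := hR (fi u)
      rw [hαi, ← mul_assoc, h1, neg_mul, mul_assoc, mul_assoc, hji, hij, mul_neg, neg_neg] at h3
      rw [hij]
      exact self_eq_neg.1 (eq_neg_of_add_eq_zero_left h3)
    calc α u = α u * (i * j) * (j * i) := by simp only [mul_assoc, hjj', mul_neg, hii]; simp
      _ = 0 := by rw [h2, zero_mul]
  have hβ₀ (u : U) : β u = 0 := by
    have h1 : i * β u = -(β u * i) := by simp [hβ₃, hα₀]
    -- Once `α = 0`, `β` anticommutes with `i` and `j`, hence commutes with `ij = k`. It also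
    -- anticommutes with `k`, so `β k = 0`.
    have h2 : β u * k + k * β u = 0 := by
      have h3 := hβP (fj u)
      rw [hβj, hβj, mul_assoc (β u), hjj, mul_neg_one, neg_mul, mul_neg, ← neg_add, hα₀, zero_mul,
        mul_zero, add_zero, neg_zero, neg_eq_zero] at h3
      exact h3
    have h3 : β u * (i * j) = 0 := by
      rw [← hij, mul_assoc i, hβ₁, mul_neg, ← mul_assoc i, h1, neg_mul, neg_neg, mul_assoc] at h2
      exact self_eq_neg.1 (eq_neg_of_add_eq_zero_left h2)
    calc β u = β u * (i * j) * (j * i) := by simp only [mul_assoc, hjj', mul_neg, hii]; simp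
      _ = 0 := by rw [h3, zero_mul]
  exact ⟨hα₀ u, hβ₀ u, by rw [hγ, hα₀, hβ₀, zero_mul, mul_zero, add_zero]⟩

end PointwiseAlgebra

/-! ### Christoffel symbols at a point from the Koszul formula. -/

section Christoffel

variable {E : Type*} [NormedAddCommGroup E] [NormedSpace ℝ E]

/-- The Christoffel symbols of a metric with value `g` and derivative `dg` at a point of `E`. -/
def christoffel (g : E →L[ℝ] E →L[ℝ] ℝ) (dg : E →L[ℝ] E →L[ℝ] E →L[ℝ] ℝ) : E →L[ℝ] E →L[ℝ] E :=
  (ContinuousLinearMap.compL ℝ E (E →L[ℝ] ℝ) E g.inverse) ∘L ((1 / 2 : ℝ) • (dg + dg.flip -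
    (ContinuousLinearMap.flipₗᵢ ℝ E E ℝ).toContinuousLinearEquiv.toContinuousLinearMap ∘L dg.flip))

variable {g : E →L[ℝ] E →L[ℝ] ℝ} {dg : E →L[ℝ] E →L[ℝ] E →L[ℝ] ℝ}

/-- The Koszul formula on constant fields. Invertibility is needed because
`ContinuousLinearMap.inverse` has a default value on non-invertible maps. -/
theorem apply_christoffel (hg : g.IsInvertible) (u v w : E) :
    g (christoffel g dg u v) w = 1 / 2 * (dg u v w + dg v u w - dg w u v) := by
  have h : ∀ f, g (g.inverse f) = f := fun f ↦ by
    obtain ⟨e, rfl⟩ := hg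
    simp
  simp [christoffel, h]

theorem christoffel_symm (hdg : ∀ u v w, dg u v w = dg u w v) (u v : E) :
    christoffel g dg u v = christoffel g dg v u := by
  simp only [christoffel, ContinuousLinearMap.comp_apply, ContinuousLinearMap.compL_apply]
  congr 1
  ext w
  simp [hdg w u v, add_comm]

theorem christoffel_metric (hg : g.IsInvertible) (hsymm : ∀ v w, g v w = g w v)
    (hdg : ∀ u v w, dg u v w = dg u w v) (u v w : E) :
    dg u v w = g (christoffel g dg u v) w + g v (christoffel g dg u w) := by
  rw [hsymm v, apply_christoffel hg, apply_christoffel hg, hdg u w v, hdg v u w, hdg w u v]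
  ring

end Christoffel

/-! ### Covariant derivatives of endomorphism fields on an open piece of `E`. -/

section FlatDerivative

variable {E : Type*} [NormedAddCommGroup E] [NormedSpace ℝ E]

/-- The derivative of a field of (skew-)symmetric bilinear forms is (skew-)symmetric. -/
theorem fderiv_apply_swap {B : E → E →L[ℝ] E →L[ℝ] ℝ} {p : E} {c : ℝ}
    (hB : DifferentiableAt ℝ B p) (h : ∀ᶠ z in nhds p, ∀ v w, B z v w = c * B z w v) (u v w : E) :
    fderiv ℝ B p u v w = c * fderiv ℝ B p u w v := by
  have hval (v w : E) : HasFDerivAt (fun z ↦ B z v w) (((fderiv ℝ B p).flip v).flip w) p := by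
    simpa using (hB.hasFDerivAt.clm_apply (hasFDerivAt_const v p)).clm_apply (hasFDerivAt_const w p)
  have heq : (fun z ↦ B z v w) =ᶠ[nhds p] fun z ↦ c * B z w v := h.mono fun z hz ↦ hz v w
  exact congr($((hval v w).unique (((hval w v).const_mul c).congr_of_eventuallyEq heq)) u)

/-- The covariant derivative at `p` of a field `A` of endomorphisms of `E`, for the connection with
Christoffel symbols `Γ` at `p`. -/
def nablaEnd (Γ : E →L[ℝ] E →L[ℝ] E) (A : E → E →L[ℝ] E) (p u : E) : E →L[ℝ] E :=
  fderiv ℝ A p u + Γ u * A p - A p * Γ u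

variable {Γ : E →L[ℝ] E →L[ℝ] E} {A B : E → E →L[ℝ] E} {p : E}

/-- Both `d` and the commutator with `Γ u` are derivations for composition. This is what allows the
quaternion relations to be differentiated. -/
theorem nablaEnd_mul (hA : DifferentiableAt ℝ A p) (hB : DifferentiableAt ℝ B p) (u : E) :
    nablaEnd Γ (fun z ↦ A z * B z) p u = nablaEnd Γ A p u * B p + A p * nablaEnd Γ B p u := by
  have h : fderiv ℝ (fun z ↦ A z * B z) p u = A p * fderiv ℝ B p u + fderiv ℝ A p u * B p := by
    rw [fderiv_fun_mul' hA hB]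
    rfl
  simp only [nablaEnd, h]
  noncomm_ring

theorem nablaEnd_neg (u : E) : nablaEnd Γ (fun z ↦ -A z) p u = -nablaEnd Γ A p u := by
  simp only [nablaEnd, fderiv_fun_neg, neg_apply]
  noncomm_ring

theorem nablaEnd_neg_one (u : E) : nablaEnd Γ (fun _ ↦ (-1 : E →L[ℝ] E)) p u = 0 := by
  simp [nablaEnd]

theorem nablaEnd_congr (h : A =ᶠ[nhds p] B) (u : E) : nablaEnd Γ A p u = nablaEnd Γ B p u := by
  simp only [nablaEnd, h.fderiv_eq, h.eq_of_nhds]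

/-- An almost complex structure whose fundamental form is closed has a covariant derivative which
is complex linear in the direction of differentiation. -/
theorem nablaEnd_complexLinear {g : E → E →L[ℝ] E →L[ℝ] ℝ} (hg : DifferentiableAt ℝ g p)
    (hA : DifferentiableAt ℝ A p) (hΓ : ∀ u v, Γ u v = Γ v u)
    (hinj : Function.Injective (g p))
    (hmetric : ∀ u v w, fderiv ℝ g p u v w = g p (Γ u v) w + g p v (Γ u w))
    (hAA : ∀ᶠ z in nhds p, A z * A z = -1)
    (hskew : ∀ᶠ z in nhds p, ∀ v w, g z (A z v) w = -g z (A z w) v)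
    (hskew' : ∀ v w, g p (A p v) w = -g p v (A p w))
    (hclosed : ∀ u v w, fderiv ℝ (fun z ↦ g z ∘L A z) p u v w
      + fderiv ℝ (fun z ↦ g z ∘L A z) p v w u + fderiv ℝ (fun z ↦ g z ∘L A z) p w u v = 0)
    (u : E) : nablaEnd Γ A p (A p u) = nablaEnd Γ A p u * A p := by
  set Ω : E → E →L[ℝ] E →L[ℝ] ℝ := fun z ↦ g z ∘L A z with hΩ
  have hΩd : DifferentiableAt ℝ Ω p := hg.clm_comp hA
  have hdΩ (u v w : E) : fderiv ℝ Ω p u v w = fderiv ℝ g p u (A p v) w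
      + g p (fderiv ℝ A p u v) w := by
    rw [hΩ, fderiv_clm_comp hg hA]
    simp [add_comm]
  have hdskew (u v w : E) : fderiv ℝ Ω p u v w = -fderiv ℝ Ω p u w v := by
    rw [fderiv_apply_swap (c := -1) hΩd (by simpa [hΩ] using hskew), neg_one_mul]
  have hAp (v : E) : A p (A p v) = -v := congr($(hAA.self_of_nhds) v)
  have hdAA (u v : E) : nablaEnd Γ A p u (A p v) = -A p (nablaEnd Γ A p u v) := by
    have h := nablaEnd_mul (Γ := Γ) hA hA u
    rw [nablaEnd_congr hAA, nablaEnd_neg_one] at h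
    exact eq_neg_of_add_eq_zero_left congr($h.symm v)
  -- As `∇g = 0`, the form `g((∇_u A)v, w)` is `(∇_u Ω)(v, w)`, here expanded through `Γ`.
  have key (u v w : E) : g p (nablaEnd Γ A p u v) w
      = fderiv ℝ Ω p u v w - g p (A p (Γ u v)) w - g p (A p v) (Γ u w) := by
    rw [hdΩ, hmetric]
    simp only [nablaEnd, sub_apply, add_apply,
      mul_apply_eq_comp, map_add, map_sub]
    ring
  have hs := hskew.self_of_nhds
  refine ContinuousLinearMap.ext fun v ↦ hinj (ContinuousLinearMap.ext fun w ↦ ?_)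
  refine complexLinear_of_cyclic (a := fun u v w ↦ g p (nablaEnd Γ A p u v) w) hAp ?_ ?_ ?_ u v w
  · intro u v w
    simp
  · intro u v w
    rw [hdAA, map_neg, neg_apply, hskew', neg_neg]
  · intro u v w
    simp only [key]
    -- In the cyclic sum the `Γ` terms cancel in pairs, by skewness of `Ω` and symmetry of `Γ`; what
    -- is left is the cyclic sum of `dΩ`.
    rw [hs v (Γ u w), hs w (Γ v u), hs u (Γ w v), hΓ v u, hΓ w v, hΓ w u]
    linarith [hclosed u v w]

/-- The covariant derivatives of three almost complex structures with the quaternion relations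
and closed fundamental forms vanish. -/
theorem nablaEnd_eq_zero {I J K : E → E →L[ℝ] E}
    (hI : DifferentiableAt ℝ I p) (hJ : DifferentiableAt ℝ J p)
    (hII : ∀ᶠ z in nhds p, I z * I z = -1) (hJJ : ∀ᶠ z in nhds p, J z * J z = -1)
    (hIJ : ∀ᶠ z in nhds p, I z * J z = K z) (hJI : ∀ᶠ z in nhds p, J z * I z = -K z)
    (hIlin : ∀ u, nablaEnd Γ I p (I p u) = nablaEnd Γ I p u * I p)
    (hJlin : ∀ u, nablaEnd Γ J p (J p u) = nablaEnd Γ J p u * J p)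
    (hKlin : ∀ u, nablaEnd Γ K p (K p u) = nablaEnd Γ K p u * K p) (u : E) :
    nablaEnd Γ I p u = 0 ∧ nablaEnd Γ J p u = 0 ∧ nablaEnd Γ K p u = 0 := by
  have hKI : K p * I p = J p := by
    rw [← hIJ.self_of_nhds, mul_assoc, hJI.self_of_nhds, ← hIJ.self_of_nhds, mul_neg, ← mul_assoc,
      hII.self_of_nhds, neg_one_mul, neg_neg]
  have : IsAddTorsionFree (E →L[ℝ] E) := .of_isTorsionFree ℝ _
  refine eq_zero_of_quaternion_derivation (fi := I p) (fj := J p) (fk := K p) (k := K p)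
    hII.self_of_nhds hJJ.self_of_nhds hIJ.self_of_nhds hJI.self_of_nhds (fun u ↦ congr($hKI u))
    (fun u ↦ ?_) (fun u ↦ ?_) (fun u ↦ ?_) (fun u ↦ ?_) hIlin hJlin hKlin u
  · rw [← nablaEnd_mul hI hI, nablaEnd_congr hII, nablaEnd_neg_one]
  · rw [← nablaEnd_mul hJ hJ, nablaEnd_congr hJJ, nablaEnd_neg_one]
  · rw [← nablaEnd_mul hI hJ, nablaEnd_congr hIJ]
  · rw [← nablaEnd_mul hJ hI, nablaEnd_congr hJI, nablaEnd_neg]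

end FlatDerivative

/-! ### Reading vector fields, forms and endomorphisms in the preferred chart at a point. -/

section Reading

variable {E : Type*} [NormedAddCommGroup E] [NormedSpace ℝ E]
  {X : Type*} [TopologicalSpace X] [ChartedSpace E X] [IsManifold 𝓘(ℝ, E) ∞ X]

/-- The preferred trivialization at `x` of the tangent bundle, at the point `y`. -/
def toCoord (x y : X) : TangentSpace 𝓘(ℝ, E) y →L[ℝ] E :=
  (trivializationAt E (TangentSpace 𝓘(ℝ, E) : X → Type _) x).continuousLinearMapAt ℝ y

/-- The inverse of `toCoord x y`. -/
def ofCoord (x y : X) : E →L[ℝ] TangentSpace 𝓘(ℝ, E) y :=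
  (trivializationAt E (TangentSpace 𝓘(ℝ, E) : X → Type _) x).symmL ℝ y

theorem toCoord_ofCoord {x y : X} (hy : y ∈ (chartAt E x).source) (v : E) :
    toCoord x y (ofCoord x y v) = v :=
  (trivializationAt E (TangentSpace 𝓘(ℝ, E) : X → Type _) x).continuousLinearMapAt_symmL hy v

theorem ofCoord_toCoord {x y : X} (hy : y ∈ (chartAt E x).source) (v : TangentSpace 𝓘(ℝ, E) y) :
    ofCoord x y (toCoord x y v) = v :=
  (trivializationAt E (TangentSpace 𝓘(ℝ, E) : X → Type _) x).symmL_continuousLinearMapAt hy v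

theorem toCoord_eq_mfderiv {x y : X} (hy : y ∈ (chartAt E x).source) :
    (toCoord x y : TangentSpace 𝓘(ℝ, E) y →L[ℝ] E) = mfderiv% (extChartAt 𝓘(ℝ, E) x) y :=
  have : IsManifold 𝓘(ℝ, E) 1 X := .of_le (n := ∞) (by simp)
  TangentBundle.continuousLinearMapAt_trivializationAt hy

theorem ofCoord_eq_mfderiv {x y : X} (hy : y ∈ (chartAt E x).source) :
    (ofCoord x y : E →L[ℝ] TangentSpace 𝓘(ℝ, E) y) = mfderiv[Set.range 𝓘(ℝ, E)] (extChartAt 𝓘(ℝ, E) x).symm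
      (extChartAt 𝓘(ℝ, E) x y) :=
  have : IsManifold 𝓘(ℝ, E) 1 X := .of_le (n := ∞) (by simp)
  TangentBundle.symmL_trivializationAt hy

/-- The fibre at `x` is `E` itself, and the chart preferred at `x` has identity derivative there.
Values at `chartPt x` therefore agree with the original tensors without any change of frame. -/
theorem toCoord_self (x : X) (v : TangentSpace 𝓘(ℝ, E) x) : toCoord x x v = v := by
  have : IsManifold 𝓘(ℝ, E) 1 X := .of_le (n := ∞) (by simp)
  rw [toCoord_eq_mfderiv (mem_chart_source E x), mfderiv_extChartAt_self]
  rfl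

theorem ofCoord_self (x : X) (v : E) : ofCoord x x v = v := by
  rw [← toCoord_self x (ofCoord x x v), toCoord_ofCoord (mem_chart_source E x)]

/-- The inverse of the preferred chart at `x`. -/
def chartInv (x : X) : E → X := (extChartAt 𝓘(ℝ, E) x).symm

/-- The image of `x` in its preferred chart. -/
def chartPt (x : X) : E := extChartAt 𝓘(ℝ, E) x x

omit [IsManifold 𝓘(ℝ, E) ∞ X] in
theorem chartInv_chartPt (x : X) : chartInv x (chartPt x : E) = x :=
  extChartAt_to_inv x

omit [IsManifold 𝓘(ℝ, E) ∞ X] in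
theorem eventually_chartInv_mem (x : X) :
    ∀ᶠ z in nhds (chartPt x : E), chartInv x z ∈ (chartAt E x).source := by
  filter_upwards [extChartAt_target_mem_nhds (I := 𝓘(ℝ, E)) x] with z hz
  rw [← extChartAt_source 𝓘(ℝ, E)]
  exact (extChartAt 𝓘(ℝ, E) x).map_target hz

omit [IsManifold 𝓘(ℝ, E) ∞ X] in
theorem eventually_chart_chartInv (x : X) :
    ∀ᶠ z in nhds (chartPt x : E), extChartAt 𝓘(ℝ, E) x (chartInv x z) = z := by
  filter_upwards [extChartAt_target_mem_nhds (I := 𝓘(ℝ, E)) x] with z hz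
  exact (extChartAt 𝓘(ℝ, E) x).right_inv hz

/-- A vector field in the preferred chart at `x`. -/
def readVec (x : X) (V : ∀ y : X, TangentSpace 𝓘(ℝ, E) y) (z : E) : E :=
  toCoord x (chartInv x z) (V (chartInv x z))

theorem readVec_chartPt (x : X) (V : ∀ y : X, TangentSpace 𝓘(ℝ, E) y) :
    readVec x V (chartPt x) = V x := by
  -- The base point is generalized because `chartInv x (chartPt x) = x` is only a propositional
  -- equality and the type of `V y` depends on `y`.
  have h (y : X) (hy : y = x) : toCoord x y (V y) = V x := by
    subst hy
    exact toCoord_self _ _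
  exact h _ (chartInv_chartPt x)

/-- An endomorphism of a tangent space in the coordinates of the preferred chart at `x`. -/
def coordEnd (x y : X) (A : TangentSpace 𝓘(ℝ, E) y →L[ℝ] TangentSpace 𝓘(ℝ, E) y) : E →L[ℝ] E :=
  toCoord x y ∘L A ∘L ofCoord x y

/-- A bilinear form on a tangent space in the coordinates of the preferred chart at `x`. -/
def coordBil (x y : X) (b : TangentSpace 𝓘(ℝ, E) y →L[ℝ] TangentSpace 𝓘(ℝ, E) y →L[ℝ] ℝ) :
    E →L[ℝ] E →L[ℝ] ℝ :=
  (ofCoord x y).precomp ℝ ∘L b ∘L ofCoord x y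

/-- A field of endomorphisms in the preferred chart at `x`. -/
def readEnd (x : X) (A : EndField E X) (z : E) : E →L[ℝ] E := coordEnd x _ (A (chartInv x z))

/-- A field of bilinear forms in the preferred chart at `x`. -/
def readBil (x : X) (b : BilinField E X) (z : E) : E →L[ℝ] E →L[ℝ] ℝ :=
  coordBil x _ (b (chartInv x z))

theorem coordBil_apply (x y : X)
    (b : TangentSpace 𝓘(ℝ, E) y →L[ℝ] TangentSpace 𝓘(ℝ, E) y →L[ℝ] ℝ) (v w : E) :
    coordBil x y b v w = b (ofCoord x y v) (ofCoord x y w) := rfl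

theorem coordEnd_apply (x y : X)
    (A : TangentSpace 𝓘(ℝ, E) y →L[ℝ] TangentSpace 𝓘(ℝ, E) y) (v : E) :
    coordEnd x y A v = toCoord x y (A (ofCoord x y v)) := rfl

theorem EndField.isSmooth_iff_coord {A : EndField E X} :
    A.IsSmooth ↔ ∀ x, ContMDiffAt 𝓘(ℝ, E) 𝓘(ℝ, E →L[ℝ] E) ∞ (fun y ↦ coordEnd x y (A y)) x := by
  refine forall_congr' fun x ↦ ?_
  rw [contMDiffAt_hom_bundle]
  exact and_iff_right contMDiffAt_id

theorem BilinField.isSmooth_iff_coord {b : BilinField E X} :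
    b.IsSmooth ↔ ∀ x, ContMDiffAt 𝓘(ℝ, E) 𝓘(ℝ, E →L[ℝ] E →L[ℝ] ℝ) ∞
      (fun y ↦ coordBil x y (b y)) x := by
  refine forall_congr' fun x ↦ ?_
  rw [contMDiffAt_hom_bundle]
  refine (and_iff_right contMDiffAt_id).trans (Filter.EventuallyEq.contMDiffAt_iff ?_)
  filter_upwards [(chartAt E x).open_source.mem_nhds (mem_chart_source E x)] with y hy
  ext v w
  rw [inCoordinates_apply_eq₂ hy hy (Set.mem_univ _)]
  refine (LinearMap.congr_fun (Bundle.Trivial.linearMapAt_trivialization ℝ X ℝ y) _).trans ?_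
  simp only [LinearMap.id_coe, id_eq]
  rw [coordBil_apply, ofCoord, Bundle.Trivialization.symmL_apply, Bundle.Trivialization.symmL_apply]
  all_goals exact hy

theorem mdifferentiableAt_iff_comp_chartInv {F : Type*} [NormedAddCommGroup F] [NormedSpace ℝ F]
    {f : X → F} {x : X} : MDifferentiableAt 𝓘(ℝ, E) 𝓘(ℝ, F) f x ↔
      DifferentiableAt ℝ (fun z : E ↦ f (chartInv x z)) (chartPt x) := by
  have : IsManifold 𝓘(ℝ, E) 1 X := .of_le (n := ∞) (by simp)
  rw [mdifferentiableAt_iff_source_of_mem_source (mem_chart_source E x),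
    mdifferentiableWithinAt_iff_differentiableWithinAt, ModelWithCorners.range_eq_univ,
    differentiableWithinAt_univ]
  rfl

omit [IsManifold 𝓘(ℝ, E) ∞ X] in
theorem mvfderiv_eq_fderiv {F : Type*} [NormedAddCommGroup F] [NormedSpace ℝ F]
    {f : X → F} {x : X} (hf : MDifferentiableAt 𝓘(ℝ, E) 𝓘(ℝ, F) f x) (u : TangentSpace 𝓘(ℝ, E) x) :
    mvfderiv 𝓘(ℝ, E) f x u = fderiv ℝ (fun z : E ↦ f (chartInv x z)) (chartPt x) u := by
  let L : E →L[ℝ] F := mfderiv 𝓘(ℝ, E) 𝓘(ℝ, F) f x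
  have h : HasFDerivAt (fun z : E ↦ f (chartInv x z)) L (chartPt x) := hasFDerivWithinAt_univ.1 <|
    (ModelWithCorners.range_eq_univ 𝓘(ℝ, E)) ▸ hf.hasMFDerivAt.2
  exact congr($(h.fderiv.symm) u)

theorem differentiableAt_readVec {x : X} {V : ∀ y : X, TangentSpace 𝓘(ℝ, E) y}
    (hV : MDiffAt (T% V) x) : DifferentiableAt ℝ (readVec x V) (chartPt x) := by
  have h := (mdifferentiableAt_section _ _).1 hV
  refine (mdifferentiableAt_iff_comp_chartInv (f := fun y ↦ toCoord x y (V y))).1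
    (h.congr_of_eventuallyEq ?_)
  filter_upwards [(chartAt E x).open_source.mem_nhds (mem_chart_source E x)] with y hy
  exact congr_fun ((trivializationAt E (TangentSpace 𝓘(ℝ, E) : X → Type _) x).coe_linearMapAt_of_mem
    hy) _

theorem differentiableAt_readEnd {A : EndField E X} (hA : A.IsSmooth) (x : X) :
    DifferentiableAt ℝ (readEnd x A) (chartPt x) :=
  mdifferentiableAt_iff_comp_chartInv.1 ((EndField.isSmooth_iff_coord.1 hA x).mdifferentiableAt (by simp))

theorem differentiableAt_readBil {b : BilinField E X} (hb : b.IsSmooth) (x : X) :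
    DifferentiableAt ℝ (readBil x b) (chartPt x) :=
  mdifferentiableAt_iff_comp_chartInv.1 ((BilinField.isSmooth_iff_coord.1 hb x).mdifferentiableAt (by simp))

/-- The manifold bracket is the bracket of the pullbacks to the chart, carried back by the inverse
derivative of the chart. Near `chartPt x` the pullbacks are the readings, and at `x` that derivative
is the identity. -/
theorem mlieBracket_eq_readVec [CompleteSpace E] (x : X) (V W : ∀ y : X, TangentSpace 𝓘(ℝ, E) y) :
    VectorField.mlieBracket 𝓘(ℝ, E) V W x =
      fderiv ℝ (readVec x W) (chartPt x) (V x) - fderiv ℝ (readVec x V) (chartPt x) (W x) := by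
  have : IsManifold 𝓘(ℝ, E) 1 X := .of_le (n := ∞) (by simp)
  have hread (U : ∀ y : X, TangentSpace 𝓘(ℝ, E) y) :
      VectorField.mpullbackWithin 𝓘(ℝ, E) 𝓘(ℝ, E) (extChartAt 𝓘(ℝ, E) x).symm U
        (Set.range 𝓘(ℝ, E)) =ᶠ[nhds (chartPt x)] readVec x U := by
    filter_upwards [eventually_chartInv_mem x, eventually_chart_chartInv x] with z hz hz'
    have h := ofCoord_eq_mfderiv hz
    rw [hz'] at h
    have hinv : (ofCoord x (chartInv x z) : E →L[ℝ] _).inverse = toCoord x (chartInv x z) :=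
      ContinuousLinearMap.inverse_eq (ContinuousLinearMap.ext (ofCoord_toCoord hz))
        (ContinuousLinearMap.ext (toCoord_ofCoord hz))
    rw [readVec, ← hinv, h]
    rfl
  have hx := mem_chart_source E x
  have hinv : (toCoord x x : TangentSpace 𝓘(ℝ, E) x →L[ℝ] E).inverse = ofCoord x x :=
    ContinuousLinearMap.inverse_eq (ContinuousLinearMap.ext (toCoord_ofCoord hx))
      (ContinuousLinearMap.ext (ofCoord_toCoord hx))
  have hinv' (w : E) : (mfderiv 𝓘(ℝ, E) 𝓘(ℝ, E) (extChartAt 𝓘(ℝ, E) x) x).inverse w = w :=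
    (congrArg (fun L : TangentSpace 𝓘(ℝ, E) x →L[ℝ] E ↦ L.inverse w)
      (toCoord_eq_mfderiv hx).symm).trans ((congr($hinv w)).trans (ofCoord_self x w))
  have hset : (extChartAt 𝓘(ℝ, E) x).symm ⁻¹' (Set.univ : Set X) ∩ Set.range 𝓘(ℝ, E) = Set.univ := by
    simp
  have key (V' W' : E → E) (hV : V' =ᶠ[nhds (chartPt x)] readVec x V)
      (hW : W' =ᶠ[nhds (chartPt x)] readVec x W) :
      VectorField.lieBracketWithin ℝ V' W' Set.univ (chartPt x) =
        fderiv ℝ (readVec x W) (chartPt x) (V x) - fderiv ℝ (readVec x V) (chartPt x) (W x) := by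
    rw [VectorField.lieBracketWithin_univ, hV.lieBracket_vectorField_eq hW, VectorField.lieBracket,
      readVec_chartPt, readVec_chartPt]
  rw [← VectorField.mlieBracketWithin_univ, VectorField.mlieBracketWithin_apply, hset]
  exact (hinv' _).trans (key _ _ (hread V) (hread W))

end Reading

/-! ### Compatibility of the readings with algebra, the Leibniz rule, and closedness in a chart. -/

section Coordinates

variable {E : Type*} [NormedAddCommGroup E] [NormedSpace ℝ E]
  {X : Type*} [TopologicalSpace X] [ChartedSpace E X] [IsManifold 𝓘(ℝ, E) ∞ X]

theorem coordBil_toCoord {x y : X} (hy : y ∈ (chartAt E x).source)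
    (b : TangentSpace 𝓘(ℝ, E) y →L[ℝ] TangentSpace 𝓘(ℝ, E) y →L[ℝ] ℝ)
    (v w : TangentSpace 𝓘(ℝ, E) y) :
    coordBil x y b (toCoord x y v) (toCoord x y w) = b v w := by
  rw [coordBil_apply, ofCoord_toCoord hy, ofCoord_toCoord hy]

theorem coordEnd_toCoord {x y : X} (hy : y ∈ (chartAt E x).source)
    (A : TangentSpace 𝓘(ℝ, E) y →L[ℝ] TangentSpace 𝓘(ℝ, E) y) (v : TangentSpace 𝓘(ℝ, E) y) :
    coordEnd x y A (toCoord x y v) = toCoord x y (A v) := by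
  rw [coordEnd_apply, ofCoord_toCoord hy]

theorem coordBil_comp {x y : X} (hy : y ∈ (chartAt E x).source)
    (b : TangentSpace 𝓘(ℝ, E) y →L[ℝ] TangentSpace 𝓘(ℝ, E) y →L[ℝ] ℝ)
    (A : TangentSpace 𝓘(ℝ, E) y →L[ℝ] TangentSpace 𝓘(ℝ, E) y) :
    coordBil x y (b ∘L A) = coordBil x y b ∘L coordEnd x y A := by
  ext v w
  rw [ContinuousLinearMap.comp_apply, coordBil_apply, coordBil_apply, coordEnd_apply,
    ofCoord_toCoord hy]
  rfl

theorem coordEnd_comp {x y : X} (hy : y ∈ (chartAt E x).source)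
    (A B : TangentSpace 𝓘(ℝ, E) y →L[ℝ] TangentSpace 𝓘(ℝ, E) y) :
    coordEnd x y (A ∘L B) = coordEnd x y A * coordEnd x y B := by
  ext v
  rw [mul_apply_eq_comp, coordEnd_apply, coordEnd_apply, coordEnd_apply, ofCoord_toCoord hy]
  rfl

theorem coordEnd_one {x y : X} (hy : y ∈ (chartAt E x).source) :
    coordEnd x y (1 : TangentSpace 𝓘(ℝ, E) y →L[ℝ] TangentSpace 𝓘(ℝ, E) y) = 1 := by
  ext v
  exact toCoord_ofCoord hy v

theorem coordEnd_neg (x y : X) (A : TangentSpace 𝓘(ℝ, E) y →L[ℝ] TangentSpace 𝓘(ℝ, E) y) :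
    coordEnd x y (-A) = -coordEnd x y A := by
  ext v
  exact map_neg (toCoord x y) _

theorem readEnd_chartPt (x : X) (A : EndField E X) (v : E) :
    readEnd x A (chartPt x) v = A x v := by
  have h (y : X) (hy : y = x) : coordEnd x y (A y) v = A x v := by
    subst hy
    rw [coordEnd_apply, toCoord_self, ofCoord_self]
  exact h _ (chartInv_chartPt x)

theorem readBil_chartPt (x : X) (b : BilinField E X) (v w : E) :
    readBil x b (chartPt x) v w = b x v w := by
  have h (y : X) (hy : y = x) : coordBil x y (b y) v w = b x v w := by
    subst hy
    rw [coordBil_apply, ofCoord_self, ofCoord_self]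
  exact h _ (chartInv_chartPt x)

theorem eventually_readVec_apply (x : X) (A : EndField E X) (V : ∀ y : X, TangentSpace 𝓘(ℝ, E) y) :
    readVec x (fun y ↦ A y (V y)) =ᶠ[nhds (chartPt x)] fun z ↦ readEnd x A z (readVec x V z) := by
  filter_upwards [eventually_chartInv_mem x] with z hz
  exact (coordEnd_toCoord hz _ _).symm

theorem eventually_readBil_apply (x : X) (b : BilinField E X)
    (V W : ∀ y : X, TangentSpace 𝓘(ℝ, E) y) :
    (fun z ↦ b (chartInv x z) (V (chartInv x z)) (W (chartInv x z))) =ᶠ[nhds (chartPt x)]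
      fun z ↦ readBil x b z (readVec x V z) (readVec x W z) := by
  filter_upwards [eventually_chartInv_mem x] with z hz
  exact (coordBil_toCoord hz _ _ _).symm

omit [IsManifold 𝓘(ℝ, E) ∞ X] in
theorem fderiv_bilin_apply {B : E → E →L[ℝ] E →L[ℝ] ℝ} {f h : E → E} {p : E}
    (hB : DifferentiableAt ℝ B p) (hf : DifferentiableAt ℝ f p) (hh : DifferentiableAt ℝ h p)
    (u : E) : fderiv ℝ (fun z ↦ B z (f z) (h z)) p u =
      fderiv ℝ B p u (f p) (h p) + B p (fderiv ℝ f p u) (h p) + B p (f p) (fderiv ℝ h p u) := by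
  rw [fderiv_clm_apply (hB.clm_apply hf) hh, fderiv_clm_apply hB hf]
  simp
  ring

/-- The Leibniz rule for a bilinear form evaluated at two vector fields, in a chart. -/
theorem mvfderiv_bilin {b : BilinField E X} (hb : b.IsSmooth) {x : X}
    {V W : ∀ y : X, TangentSpace 𝓘(ℝ, E) y} (hV : MDiffAt (T% V) x) (hW : MDiffAt (T% W) x)
    (u : E) :
    mvfderiv 𝓘(ℝ, E) (fun y ↦ b y (V y) (W y)) x u =
      fderiv ℝ (readBil x b) (chartPt x) u (readVec x V (chartPt x)) (readVec x W (chartPt x))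
        + readBil x b (chartPt x) (fderiv ℝ (readVec x V) (chartPt x) u) (readVec x W (chartPt x))
        + readBil x b (chartPt x) (readVec x V (chartPt x))
          (fderiv ℝ (readVec x W) (chartPt x) u) := by
  have hb' := differentiableAt_readBil hb x
  have hV' := differentiableAt_readVec hV
  have hW' := differentiableAt_readVec hW
  have heq := eventually_readBil_apply x b V W
  rw [← fderiv_bilin_apply hb' hV' hW', ← heq.fderiv_eq]
  exact mvfderiv_eq_fderiv (mdifferentiableAt_iff_comp_chartInv.2
    (((hb'.clm_apply hV').clm_apply hW').congr_of_eventuallyEq heq)) u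

/-- The vector field which is constant in the preferred chart at `x`. -/
def constField (x : X) (v : E) (y : X) : TangentSpace 𝓘(ℝ, E) y := ofCoord x y v

theorem contMDiffAt_constField (x : X) (v : E) : CMDiffAt ∞ (T% (constField x v)) x := by
  rw [Bundle.contMDiffAt_section]
  refine (contMDiffAt_const (c := v)).congr_of_eventuallyEq ?_
  filter_upwards [(chartAt E x).open_source.mem_nhds (mem_chart_source E x)] with y hy
  refine Eq.trans ?_ (toCoord_ofCoord hy v)
  exact (congr_fun ((trivializationAt E (TangentSpace 𝓘(ℝ, E) : X → Type _) x).coe_linearMapAt_of_mem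
    hy) _).symm

theorem fderiv_readVec_constField (x : X) (v : E) :
    fderiv ℝ (readVec x (constField x v)) (chartPt x) = 0 := by
  have h : readVec x (constField x v) =ᶠ[nhds (chartPt x)] fun _ ↦ v := by
    filter_upwards [eventually_chartInv_mem x] with z hz
    exact toCoord_ofCoord hz v
  rw [h.fderiv_eq, fderiv_fun_const]
  rfl

theorem readVec_constField (x : X) (v : E) : readVec x (constField x v) (chartPt x) = v :=
  toCoord_ofCoord (by rw [chartInv_chartPt]; exact mem_chart_source E x) v

omit [IsManifold 𝓘(ℝ, E) ∞ X] in
theorem BilinField.skew_of_alternating (Ω : BilinField E X) (halt : ∀ x v, Ω x v v = 0) (x : X)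
    (v w : TangentSpace 𝓘(ℝ, E) x) : Ω x v w = -Ω x w v := by
  have h := halt x (v + w)
  simp only [map_add, add_apply, halt, zero_add, add_zero] at h
  linarith

/-- The derivative in a chart of a closed two-form has vanishing cyclic sum. -/
theorem fderiv_readBil_cyclic [CompleteSpace E] {Ω : BilinField E X} (hΩ : Ω.IsSmooth)
    (halt : ∀ x v, Ω x v v = 0) (hclosed : Ω.IsClosed) (x : X) (u v w : E) :
    fderiv ℝ (readBil x Ω) (chartPt x) u v w + fderiv ℝ (readBil x Ω) (chartPt x) v w u
      + fderiv ℝ (readBil x Ω) (chartPt x) w u v = 0 := by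
  -- Closedness is tested on fields constant in the chart: their brackets vanish at `x`, and only
  -- the derivatives of the coefficients of `Ω` survive.
  have hsm (u : E) := contMDiffAt_constField x u
  have hd (u v w : E) : mvfderiv 𝓘(ℝ, E) (fun y ↦ Ω y (constField x v y) (constField x w y)) x u
      = fderiv ℝ (readBil x Ω) (chartPt x) u v w := by
    refine (mvfderiv_bilin hΩ ((hsm v).mdifferentiableAt (by simp))
      ((hsm w).mdifferentiableAt (by simp)) u).trans ?_
    rw [fderiv_readVec_constField, fderiv_readVec_constField, readVec_constField,
      readVec_constField]
    simp
  have hbr (v w : E) :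
      VectorField.mlieBracket 𝓘(ℝ, E) (constField x v) (constField x w) x = 0 := by
    rw [mlieBracket_eq_readVec, fderiv_readVec_constField, fderiv_readVec_constField]
    exact sub_self _
  have hself (v : E) : constField x v x = v := ofCoord_self x v
  have hz (a b c : E) : Ω x (VectorField.mlieBracket 𝓘(ℝ, E) (constField x a) (constField x b) x)
      (constField x c x) = 0 := by
    rw [hbr, map_zero]
    rfl
  have hd' (u v w : E) : mvfderiv 𝓘(ℝ, E) (fun y ↦ Ω y (constField x v y) (constField x w y)) x
      (constField x u x) = fderiv ℝ (readBil x Ω) (chartPt x) u v w := by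
    rw [hself, hd]
  have h : _ - _ + _ - _ + _ - _ = (0 : ℝ) :=
    hclosed x (constField x u) (constField x v) (constField x w) (hsm u) (hsm v) (hsm w)
  rw [hd', hd', hd', hz, hz, hz] at h
  -- Skewness turns the term `-dΩ(v; u, w)` of the exterior derivative into the cyclic term `dΩ(v;
  -- w, u)`.
  have hswap := fderiv_apply_swap (c := -1) (differentiableAt_readBil hΩ x)
    (.of_forall fun z v w ↦ by
      rw [neg_one_mul]
      exact Ω.skew_of_alternating halt _ _ _) v w u
  linarith

end Coordinates

/-! ### Construction of the Levi-Civita connection and the criterion for parallel endomorphisms. -/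

section LeviCivita

variable {E : Type*} [NormedAddCommGroup E] [NormedSpace ℝ E]
  {X : Type*} [TopologicalSpace X] [ChartedSpace E X] [IsManifold 𝓘(ℝ, E) ∞ X]

/-- The Christoffel symbols of `g` at `x`, in the preferred chart at `x`. -/
def christoffelAt (g : BilinField E X) (x : X) : E →L[ℝ] E →L[ℝ] E :=
  christoffel (readBil x g (chartPt x)) (fderiv ℝ (readBil x g) (chartPt x))

/-- The covariant derivative with given Christoffel symbols, read in the preferred charts. -/
def covDeriv (Γ : X → E →L[ℝ] E →L[ℝ] E) (V : ∀ y : X, TangentSpace 𝓘(ℝ, E) y) (x : X) :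
    E →L[ℝ] E :=
  fderiv ℝ (readVec x V) (chartPt x) + (Γ x).flip (readVec x V (chartPt x))

theorem covDeriv_apply (Γ : X → E →L[ℝ] E →L[ℝ] E) (V : ∀ y : X, TangentSpace 𝓘(ℝ, E) y) (x : X)
    (u : E) : covDeriv Γ V x u =
      fderiv ℝ (readVec x V) (chartPt x) u + Γ x u (readVec x V (chartPt x)) := rfl

theorem covDeriv_add (Γ : X → E →L[ℝ] E →L[ℝ] E) {V W : ∀ y : X, TangentSpace 𝓘(ℝ, E) y} {x : X}
    (hV : MDiffAt (T% V) x) (hW : MDiffAt (T% W) x) :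
    covDeriv Γ (V + W) x = covDeriv Γ V x + covDeriv Γ W x := by
  have h : readVec x (V + W) = readVec x V + readVec x W :=
    funext fun z ↦ map_add (toCoord x (chartInv x z)) _ _
  rw [covDeriv, h, fderiv_add (differentiableAt_readVec hV) (differentiableAt_readVec hW),
    Pi.add_apply, map_add, covDeriv, covDeriv]
  abel

theorem covDeriv_smul (Γ : X → E →L[ℝ] E →L[ℝ] E) {V : ∀ y : X, TangentSpace 𝓘(ℝ, E) y}
    {f : X → ℝ} {x : X} (hV : MDiffAt (T% V) x) (hf : MDifferentiableAt 𝓘(ℝ, E) 𝓘(ℝ, ℝ) f x)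
    (u : E) :
    covDeriv Γ (f • V) x u =
      f x • covDeriv Γ V x u + mvfderiv 𝓘(ℝ, E) f x u • readVec x V (chartPt x) := by
  have h : readVec x (f • V) = fun z ↦ f (chartInv x z) • readVec x V z :=
    funext fun z ↦ map_smul (toCoord x (chartInv x z)) _ _
  have hf' := mdifferentiableAt_iff_comp_chartInv.1 hf
  have hm : mvfderiv 𝓘(ℝ, E) f x u = _ := mvfderiv_eq_fderiv hf u
  rw [covDeriv_apply, covDeriv_apply, h, fderiv_fun_smul hf' (differentiableAt_readVec hV), hm,
    chartInv_chartPt]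
  simp only [add_apply, smul_apply, ContinuousLinearMap.smulRight_apply, map_smul, smul_add]
  rw [chartInv_chartPt]
  abel

/-- The Levi-Civita connection of `g`. -/
def leviCivita (g : BilinField E X) :
    CovariantDerivative 𝓘(ℝ, E) E (TangentSpace 𝓘(ℝ, E) : X → Type _) where
  -- Each point uses its own chart. The axioms of a covariant derivative are checked pointwise, so
  -- no transformation law for `Γ` is needed.
  toFun V x := (covDeriv (christoffelAt g) V x : E →L[ℝ] E)
  isCovariantDerivativeOnUniv :=
    { add := fun hV hW _ ↦ covDeriv_add _ hV hW
      leibniz := fun {V f x} hV hf _ ↦ by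
        refine ContinuousLinearMap.ext fun (u : E) ↦
          (covDeriv_smul (christoffelAt g) hV hf u).trans ?_
        rw [readVec_chartPt]
        rfl }

theorem readBil_symm {g : BilinField E X} (hg : IsPseudoRiemannianMetric g) (x : X) (z v w : E) :
    readBil x g z v w = readBil x g z w v :=
  hg.symm _ _ _

variable [FiniteDimensional ℝ E]

theorem isInvertible_of_injective {f : E →L[ℝ] E →L[ℝ] ℝ} (hf : Function.Injective f) :
    f.IsInvertible := by
  have hrank : Module.finrank ℝ E = Module.finrank ℝ (E →L[ℝ] ℝ) := by
    rw [← (LinearMap.toContinuousLinearMap (𝕜 := ℝ) (E := E) (F' := ℝ)).finrank_eq]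
    exact Subspace.dual_finrank_eq.symm
  exact ⟨(LinearEquiv.ofInjectiveOfFinrankEq (f : E →ₗ[ℝ] E →L[ℝ] ℝ) hf
    hrank).toContinuousLinearEquiv, by ext; rfl⟩

theorem isInvertible_coordBil {b : BilinField E X} (hb : b.IsNondegenerate) {x y : X}
    (hy : y ∈ (chartAt E x).source) : (coordBil x y (b y)).IsInvertible := by
  refine isInvertible_of_injective ((injective_iff_map_eq_zero _).2 fun v hv ↦ ?_)
  have h : ofCoord x y v = 0 := hb y _ fun w ↦ by
    rw [← coordBil_toCoord hy, toCoord_ofCoord hy, hv]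
    rfl
  rw [← toCoord_ofCoord hy v, h, map_zero]

theorem isInvertible_readBil {b : BilinField E X} (hb : b.IsNondegenerate) (x : X) :
    (readBil x b (chartPt x)).IsInvertible :=
  isInvertible_coordBil hb (by rw [chartInv_chartPt]; exact mem_chart_source E x)

variable {g : BilinField E X}

omit [FiniteDimensional ℝ E] in
theorem christoffelAt_symm (hg : IsPseudoRiemannianMetric g) (x : X) (u v : E) :
    christoffelAt g x u v = christoffelAt g x v u := by
  refine christoffel_symm (fun u v w ↦ ?_) u v
  rw [fderiv_apply_swap (c := 1) (differentiableAt_readBil hg.smooth x)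
    (.of_forall fun z v w ↦ by rw [one_mul, readBil_symm hg]), one_mul]

theorem christoffelAt_metric (hg : IsPseudoRiemannianMetric g) (x : X) (u v w : E) :
    fderiv ℝ (readBil x g) (chartPt x) u v w = readBil x g (chartPt x) (christoffelAt g x u v) w
      + readBil x g (chartPt x) v (christoffelAt g x u w) := by
  refine christoffel_metric (isInvertible_readBil hg.nondegenerate x) (readBil_symm hg x _)
    (fun u v w ↦ ?_) u v w
  rw [fderiv_apply_swap (c := 1) (differentiableAt_readBil hg.smooth x)
    (.of_forall fun z v w ↦ by rw [one_mul, readBil_symm hg]), one_mul]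

theorem covDeriv_metric (hg : IsPseudoRiemannianMetric g) {x : X}
    {V W : ∀ y : X, TangentSpace 𝓘(ℝ, E) y} (hV : MDiffAt (T% V) x) (hW : MDiffAt (T% W) x)
    (u : E) :
    mvfderiv 𝓘(ℝ, E) (fun y ↦ g y (V y) (W y)) x u =
      readBil x g (chartPt x) (covDeriv (christoffelAt g) V x u) (readVec x W (chartPt x))
      + readBil x g (chartPt x) (readVec x V (chartPt x)) (covDeriv (christoffelAt g) W x u) := by
  refine (mvfderiv_bilin hg.smooth hV hW u).trans ?_
  rw [christoffelAt_metric hg, covDeriv_apply, covDeriv_apply, map_add, map_add, add_apply]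
  ring

omit [FiniteDimensional ℝ E] in
theorem covDeriv_sub_covDeriv (hg : IsPseudoRiemannianMetric g) (x : X)
    (V W : ∀ y : X, TangentSpace 𝓘(ℝ, E) y) :
    covDeriv (christoffelAt g) W x (readVec x V (chartPt x))
      - covDeriv (christoffelAt g) V x (readVec x W (chartPt x)) =
      fderiv ℝ (readVec x W) (chartPt x) (readVec x V (chartPt x))
        - fderiv ℝ (readVec x V) (chartPt x) (readVec x W (chartPt x)) := by
  rw [covDeriv_apply, covDeriv_apply, christoffelAt_symm hg, add_sub_add_right_eq_sub]

/-- Both properties at `x` are read in the chart at `x`: symmetry of `Γ` makes the torsion vanish,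
and the Koszul formula makes `g` parallel. -/
theorem isLeviCivita_leviCivita (hg : IsPseudoRiemannianMetric g) :
    IsLeviCivita g (leviCivita g) where
  torsion_free x V W _ _ := by
    have h := covDeriv_sub_covDeriv hg x V W
    rw [readVec_chartPt, readVec_chartPt] at h
    exact h.trans (mlieBracket_eq_readVec x V W).symm
  metric x V W hV hW u := by
    have h := covDeriv_metric hg hV hW u
    rw [readVec_chartPt, readVec_chartPt] at h
    exact h.trans (congrArg₂ (· + ·) (readBil_chartPt x g _ _) (readBil_chartPt x g _ _))

omit [FiniteDimensional ℝ E] in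
-- The Leibniz rule `∇_u(AV) = A ∇_u V + (∇_u A)V`, which reduces parallelism of `A` to the
-- vanishing of `nablaEnd`.
theorem covDeriv_endField {Γ : X → E →L[ℝ] E →L[ℝ] E} {A : EndField E X} (hA : A.IsSmooth)
    {x : X} {V : ∀ y : X, TangentSpace 𝓘(ℝ, E) y} (hV : MDiffAt (T% V) x) (u : E) :
    covDeriv Γ (fun y ↦ A y (V y)) x u = readEnd x A (chartPt x) (covDeriv Γ V x u)
      + nablaEnd (Γ x) (readEnd x A) (chartPt x) u (readVec x V (chartPt x)) := by
  have heq := eventually_readVec_apply x A V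
  rw [covDeriv_apply, covDeriv_apply, heq.fderiv_eq,
    fderiv_clm_apply (differentiableAt_readEnd hA x) (differentiableAt_readVec hV), heq.eq_of_nhds]
  simp only [nablaEnd, sub_apply, add_apply, mul_apply_eq_comp, map_add,
    ContinuousLinearMap.comp_apply, ContinuousLinearMap.flip_apply]
  abel

omit [FiniteDimensional ℝ E] in
theorem isParallel_leviCivita {A : EndField E X} (hA : A.IsSmooth)
    (h : ∀ x u, nablaEnd (christoffelAt g x) (readEnd x A) (chartPt x) u = 0) :
    A.IsParallel (leviCivita g) := by
  intro x V hV u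
  have key (u : E) : covDeriv (christoffelAt g) (fun y ↦ A y (V y)) x u =
      readEnd x A (chartPt x) (covDeriv (christoffelAt g) V x u) := by
    rw [covDeriv_endField hA hV, h, zero_apply, add_zero]
  exact (key u).trans (readEnd_chartPt x A _)

end LeviCivita

/-! ### The quaternion relations and the metric from three forms. -/

section Algebra

variable {E : Type*} [NormedAddCommGroup E] [NormedSpace ℝ E] [FiniteDimensional ℝ E]
  {X : Type*} [TopologicalSpace X] [ChartedSpace E X] [IsManifold 𝓘(ℝ, E) ∞ X]
  {Ω₁ Ω₂ Ω₃ : SymplecticForm E X}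

theorem form_invComp (Ω₁ Ω₂ : SymplecticForm E X) (x : X) (v : TangentSpace 𝓘(ℝ, E) x) :
    Ω₁.form x (invComp Ω₁ Ω₂ x v) = Ω₂.form x v :=
  (Ω₁.iso x).apply_symm_apply _

theorem form_invComp' (h : invComp Ω₁ Ω₂ = -invComp Ω₂ Ω₁) (x : X)
    (v : TangentSpace 𝓘(ℝ, E) x) : Ω₂.form x (invComp Ω₁ Ω₂ x v) = -Ω₁.form x v := by
  rw [h, ← form_invComp Ω₂ Ω₁ x v, ← map_neg]
  rfl

/-- The hypothesis says that `Ω₁⁻¹Ω₂` is minus its own inverse. -/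
theorem invComp_mul_self (h : invComp Ω₁ Ω₂ = -invComp Ω₂ Ω₁) (x : X) :
    invComp Ω₁ Ω₂ x * invComp Ω₁ Ω₂ x = -1 := by
  refine ContinuousLinearMap.ext fun v ↦ (Ω₁.bijective x).1 ?_
  rw [mul_apply_eq_comp, form_invComp, form_invComp' h, ← map_neg]
  rfl

/-- Two sign changes turn the product into `(Ω₁⁻¹Ω₃)(Ω₃⁻¹Ω₂)`, where `Ω₃` cancels. -/
theorem invComp_mul_invComp (h₂₃ : invComp Ω₂ Ω₃ = -invComp Ω₃ Ω₂)
    (h₃₁ : invComp Ω₃ Ω₁ = -invComp Ω₁ Ω₃) (x : X) :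
    invComp Ω₃ Ω₁ x * invComp Ω₂ Ω₃ x = invComp Ω₁ Ω₂ x := by
  refine ContinuousLinearMap.ext fun v ↦ (Ω₁.bijective x).1 ?_
  rw [mul_apply_eq_comp, form_invComp, form_invComp' h₃₁, form_invComp' h₂₃, neg_neg]

omit [FiniteDimensional ℝ E] in
theorem SymplecticForm.skew (Ω : SymplecticForm E X) (x : X) (v w : TangentSpace 𝓘(ℝ, E) x) :
    Ω.form x v w = -Ω.form x w v :=
  Ω.form.skew_of_alternating Ω.alternating x v w

theorem form_invComp_left (Ω₁ Ω₂ : SymplecticForm E X) (x : X) (v w : TangentSpace 𝓘(ℝ, E) x) :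
    Ω₁.form x (invComp Ω₁ Ω₂ x v) w = Ω₁.form x v (invComp Ω₁ Ω₂ x w) := by
  rw [form_invComp, Ω₂.skew, Ω₁.skew x v, form_invComp]

theorem form_invComp_left' (h : invComp Ω₁ Ω₂ = -invComp Ω₂ Ω₁) (x : X)
    (v w : TangentSpace 𝓘(ℝ, E) x) :
    Ω₂.form x (invComp Ω₁ Ω₂ x v) w = Ω₂.form x v (invComp Ω₁ Ω₂ x w) := by
  rw [form_invComp' h, neg_apply, Ω₁.skew, Ω₂.skew x v, form_invComp' h, neg_apply]

theorem tripleComp_apply (Ω₁ Ω₂ Ω₃ : SymplecticForm E X) (x : X) (v : TangentSpace 𝓘(ℝ, E) x) :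
    tripleComp Ω₁ Ω₂ Ω₃ x v = Ω₁.form x (invComp Ω₂ Ω₃ x v) := rfl

/-- Write `Ω₂⁻¹Ω₃ = AC` with `A = Ω₁⁻¹Ω₂` and `C = Ω₃⁻¹Ω₁`. Both factors are self-adjoint for `Ω₁`
and `CA = -AC`, so moving them across gives a sign that cancels the skewness of `Ω₁`. -/
theorem tripleComp_symm (h₁₂ : invComp Ω₁ Ω₂ = -invComp Ω₂ Ω₁)
    (h₂₃ : invComp Ω₂ Ω₃ = -invComp Ω₃ Ω₂)
    (h₃₁ : invComp Ω₃ Ω₁ = -invComp Ω₁ Ω₃) (x : X) (v w : TangentSpace 𝓘(ℝ, E) x) :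
    tripleComp Ω₁ Ω₂ Ω₃ x v w = tripleComp Ω₁ Ω₂ Ω₃ x w v := by
  have hAC := invComp_mul_invComp h₃₁ h₁₂ x
  have hCA : invComp Ω₃ Ω₁ x * invComp Ω₁ Ω₂ x = -invComp Ω₂ Ω₃ x := by
    rw [← invComp_mul_invComp h₁₂ h₂₃, mul_assoc, invComp_mul_self h₁₂, mul_neg_one]
  rw [tripleComp_apply, tripleComp_apply, ← hAC, mul_apply_eq_comp, form_invComp_left,
    form_invComp_left' h₃₁, ← mul_apply_eq_comp, hCA, hAC, Ω₁.skew]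
  simp

theorem tripleComp_nondegenerate (h₂₃ : invComp Ω₂ Ω₃ = -invComp Ω₃ Ω₂) :
    (tripleComp Ω₁ Ω₂ Ω₃).IsNondegenerate := by
  intro x v hv
  have h : invComp Ω₂ Ω₃ x v = 0 := Ω₁.nondegenerate x _ hv
  refine neg_eq_zero.1 (Eq.symm ?_)
  refine Eq.trans ?_ congr($(invComp_mul_self h₂₃ x) v)
  rw [mul_apply_eq_comp, h, map_zero]

/-- The complex structures `I = -Ω₂⁻¹ ∘ Ω₃`, `J = -Ω₃⁻¹ ∘ Ω₁`, `K = -Ω₁⁻¹ ∘ Ω₂` on a tangent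
space satisfy the relations of the quaternion units. -/
def quaternionBasis (h₁₂ : invComp Ω₁ Ω₂ = -invComp Ω₂ Ω₁)
    (h₂₃ : invComp Ω₂ Ω₃ = -invComp Ω₃ Ω₂)
    (h₃₁ : invComp Ω₃ Ω₁ = -invComp Ω₁ Ω₃) (x : X) :
    QuaternionAlgebra.Basis (TangentSpace 𝓘(ℝ, E) x →L[ℝ] TangentSpace 𝓘(ℝ, E) x)
      (-1 : ℝ) 0 (-1) where
  i := -invComp Ω₂ Ω₃ x
  j := -invComp Ω₃ Ω₁ x
  k := -invComp Ω₁ Ω₂ x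
  i_mul_i := by rw [neg_mul_neg, invComp_mul_self h₂₃, zero_smul, neg_one_smul, add_zero]
  j_mul_j := by rw [neg_mul_neg, invComp_mul_self h₃₁, neg_one_smul]
  i_mul_j := by
    rw [neg_mul_neg, ← invComp_mul_invComp h₁₂ h₂₃, ← mul_assoc, invComp_mul_self h₂₃,
      neg_one_mul]
  j_mul_i := by
    rw [neg_mul_neg, invComp_mul_invComp h₂₃ h₃₁, zero_smul, zero_sub, neg_neg]

/-- The metric is `Ω₁` composed with `Ω₂⁻¹Ω₃`, whose square is `-1`; this forces the minus sign in
the choice of `I`. -/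
theorem form_eq_tripleComp_comp₁ (h₂₃ : invComp Ω₂ Ω₃ = -invComp Ω₃ Ω₂) (x : X) :
    Ω₁.form x = tripleComp Ω₁ Ω₂ Ω₃ x ∘L (-invComp Ω₂ Ω₃ x) := by
  have h := invComp_mul_self h₂₃ x
  refine ContinuousLinearMap.ext fun v ↦ ?_
  rw [ContinuousLinearMap.comp_apply, tripleComp_apply, neg_apply, map_neg, ← mul_apply_eq_comp, h,
    neg_apply, neg_neg]
  rfl

theorem form_eq_tripleComp_comp₂ (h₁₂ : invComp Ω₁ Ω₂ = -invComp Ω₂ Ω₁)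
    (h₂₃ : invComp Ω₂ Ω₃ = -invComp Ω₃ Ω₂) (x : X) :
    Ω₂.form x = tripleComp Ω₁ Ω₂ Ω₃ x ∘L (-invComp Ω₃ Ω₁ x) := by
  have h : invComp Ω₂ Ω₃ x * invComp Ω₃ Ω₁ x = -invComp Ω₁ Ω₂ x := by
    rw [← invComp_mul_invComp h₁₂ h₂₃, ← mul_assoc, invComp_mul_self h₂₃, neg_one_mul]
  refine ContinuousLinearMap.ext fun v ↦ ?_
  rw [ContinuousLinearMap.comp_apply, tripleComp_apply, neg_apply, map_neg, ← mul_apply_eq_comp, h,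
    neg_apply, neg_neg, form_invComp]

theorem form_eq_tripleComp_comp₃ (h₁₂ : invComp Ω₁ Ω₂ = -invComp Ω₂ Ω₁)
    (h₂₃ : invComp Ω₂ Ω₃ = -invComp Ω₃ Ω₂)
    (h₃₁ : invComp Ω₃ Ω₁ = -invComp Ω₁ Ω₃) (x : X) :
    Ω₃.form x = tripleComp Ω₁ Ω₂ Ω₃ x ∘L (-invComp Ω₁ Ω₂ x) := by
  refine ContinuousLinearMap.ext fun v ↦ ?_
  rw [ContinuousLinearMap.comp_apply, tripleComp_apply, neg_apply, map_neg, ← mul_apply_eq_comp,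
    invComp_mul_invComp h₁₂ h₂₃, map_neg, form_invComp' h₃₁, neg_neg]

end Algebra

/-! ### Smoothness of the endomorphism fields. -/

section Smoothness

variable {E : Type*} [NormedAddCommGroup E] [NormedSpace ℝ E]
  {X : Type*} [TopologicalSpace X] [ChartedSpace E X] [IsManifold 𝓘(ℝ, E) ∞ X]

theorem EndField.IsSmooth.neg {A : EndField E X} (hA : A.IsSmooth) :
    EndField.IsSmooth (fun x ↦ -A x) := by
  rw [EndField.isSmooth_iff_coord] at hA ⊢
  simpa only [coordEnd_neg] using fun x ↦ (hA x).neg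

theorem BilinField.IsSmooth.comp {b : BilinField E X} {A : EndField E X} (hb : b.IsSmooth)
    (hA : A.IsSmooth) : BilinField.IsSmooth (fun x ↦ b x ∘L A x) := by
  rw [EndField.isSmooth_iff_coord] at hA
  rw [BilinField.isSmooth_iff_coord] at hb ⊢
  refine fun x ↦ ((hb x).clm_comp (hA x)).congr_of_eventuallyEq ?_
  filter_upwards [(chartAt E x).open_source.mem_nhds (mem_chart_source E x)] with y hy
  exact coordBil_comp hy _ _

/-- In coordinates near `x` the field is the inverse of the matrix of `Ω₁` times the matrix of `Ω₂`,
and inversion is smooth at invertible operators. -/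
theorem isSmooth_invComp [FiniteDimensional ℝ E] (Ω₁ Ω₂ : SymplecticForm E X) :
    (invComp Ω₁ Ω₂).IsSmooth := by
  have : CompleteSpace E := FiniteDimensional.complete ℝ E
  rw [EndField.isSmooth_iff_coord]
  intro x
  have h₁ := BilinField.isSmooth_iff_coord.1 Ω₁.smooth x
  have h₂ := BilinField.isSmooth_iff_coord.1 Ω₂.smooth x
  obtain ⟨e, he⟩ := isInvertible_coordBil Ω₁.nondegenerate (mem_chart_source E x)
  have hinv := contDiffAt_map_inverse (n := ∞) e
  rw [he] at hinv
  refine ((hinv.contMDiffAt.comp x h₁).clm_comp h₂).congr_of_eventuallyEq ?_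
  filter_upwards [(chartAt E x).open_source.mem_nhds (mem_chart_source E x)] with y hy
  have h : coordBil x y (Ω₂.form y) =
      coordBil x y (Ω₁.form y) ∘L coordEnd x y (invComp Ω₁ Ω₂ y) := by
    rw [← coordBil_comp hy]
    congr 1
    exact ContinuousLinearMap.ext fun v ↦ (form_invComp Ω₁ Ω₂ y v).symm
  rw [h]
  obtain ⟨e, he⟩ := isInvertible_coordBil Ω₁.nondegenerate hy
  ext v
  simp [← he]

end Smoothness

/-! ### Real combinations of the identity and three endomorphism fields. -/

section Combination

variable {E : Type*} [NormedAddCommGroup E] [NormedSpace ℝ E]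

theorem nablaEnd_combination {Γ : E →L[ℝ] E →L[ℝ] E} {I J K : E → E →L[ℝ] E} {p : E}
    (hI : DifferentiableAt ℝ I p) (hJ : DifferentiableAt ℝ J p) (hK : DifferentiableAt ℝ K p)
    (a b c d : ℝ) (u : E) :
    nablaEnd Γ (fun z ↦ a • (1 : E →L[ℝ] E) + b • I z + c • J z + d • K z) p u =
      b • nablaEnd Γ I p u + c • nablaEnd Γ J p u + d • nablaEnd Γ K p u := by
  have h : HasFDerivAt (fun z ↦ a • (1 : E →L[ℝ] E) + b • I z + c • J z + d • K z)
      (b • fderiv ℝ I p + c • fderiv ℝ J p + d • fderiv ℝ K p) p := by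
    simpa [add_assoc] using (((hI.hasFDerivAt.const_smul b).add (hJ.hasFDerivAt.const_smul c)).add
      (hK.hasFDerivAt.const_smul d)).const_add (a • (1 : E →L[ℝ] E))
  simp only [nablaEnd, h.fderiv, add_apply, smul_apply, mul_add, add_mul, smul_add, smul_sub,
    mul_smul_comm, smul_mul_assoc, mul_one, one_mul]
  abel

variable {X : Type*} [TopologicalSpace X] [ChartedSpace E X] [IsManifold 𝓘(ℝ, E) ∞ X]

/-- The field of endomorphisms `a + bI + cJ + dK`. -/
def combination (I J K : EndField E X) (a b c d : ℝ) : EndField E X :=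
  fun x ↦ a • 1 + b • I x + c • J x + d • K x

theorem coordEnd_combination {x y : X} (hy : y ∈ (chartAt E x).source) (I J K : EndField E X)
    (a b c d : ℝ) : coordEnd x y (combination I J K a b c d y) =
      a • (1 : E →L[ℝ] E) + b • coordEnd x y (I y) + c • coordEnd x y (J y)
        + d • coordEnd x y (K y) := by
  rw [← coordEnd_one hy]
  ext v
  simp only [coordEnd_apply, combination, add_apply, smul_apply, map_add, map_smul]

variable {I J K : EndField E X}

theorem EndField.IsSmooth.combination (hI : I.IsSmooth) (hJ : J.IsSmooth) (hK : K.IsSmooth)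
    (a b c d : ℝ) : EndField.IsSmooth (combination I J K a b c d) := by
  rw [EndField.isSmooth_iff_coord] at hI hJ hK ⊢
  intro x
  have hs (r : ℝ) : ContMDiffAt 𝓘(ℝ, E) 𝓘(ℝ, ℝ) ∞ (fun _ : X ↦ r) x := contMDiffAt_const
  refine (((contMDiffAt_const (c := a • (1 : E →L[ℝ] E))).add ((hs b).smul (hI x))).add
    ((hs c).smul (hJ x)) |>.add ((hs d).smul (hK x))).congr_of_eventuallyEq ?_
  filter_upwards [(chartAt E x).open_source.mem_nhds (mem_chart_source E x)] with y hy
  exact coordEnd_combination hy I J K a b c d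

theorem nablaEnd_readEnd_combination {Γ : E →L[ℝ] E →L[ℝ] E} (hI : I.IsSmooth) (hJ : J.IsSmooth)
    (hK : K.IsSmooth) (a b c d : ℝ) (x : X) (u : E) :
    nablaEnd Γ (readEnd x (combination I J K a b c d)) (chartPt x) u =
      b • nablaEnd Γ (readEnd x I) (chartPt x) u + c • nablaEnd Γ (readEnd x J) (chartPt x) u
        + d • nablaEnd Γ (readEnd x K) (chartPt x) u := by
  rw [← nablaEnd_combination (differentiableAt_readEnd hI x) (differentiableAt_readEnd hJ x)
    (differentiableAt_readEnd hK x) a b c d u]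
  refine nablaEnd_congr ?_ u
  filter_upwards [eventually_chartInv_mem x] with z hz
  exact coordEnd_combination hz I J K a b c d

end Combination

/-! ### Closed fundamental forms make the quaternion units parallel. -/

section Parallel

variable {E : Type*} [NormedAddCommGroup E] [NormedSpace ℝ E] [FiniteDimensional ℝ E]
  {X : Type*} [TopologicalSpace X] [ChartedSpace E X] [IsManifold 𝓘(ℝ, E) ∞ X]
  {g : BilinField E X}

omit [FiniteDimensional ℝ E] in
theorem eventually_readEnd_mul {A B C : EndField E X} (h : ∀ y, A y * B y = C y) (x : X) :
    ∀ᶠ z in nhds (chartPt x), readEnd x A z * readEnd x B z = readEnd x C z := by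
  filter_upwards [eventually_chartInv_mem x] with z hz
  refine (coordEnd_comp hz _ _).symm.trans ?_
  exact congrArg (coordEnd x _) (h _)

omit [FiniteDimensional ℝ E] in
theorem eventually_readEnd_mul_self {A : EndField E X} (h : ∀ y, A y * A y = -1) (x : X) :
    ∀ᶠ z in nhds (chartPt x), readEnd x A z * readEnd x A z = -1 := by
  filter_upwards [eventually_readEnd_mul (C := fun _ ↦ -1) h x, eventually_chartInv_mem x]
    with z hz hz'
  rw [hz, readEnd, coordEnd_neg, coordEnd_one hz']

/-- An almost complex structure whose fundamental form is symplectic has a covariant derivative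
which is complex linear in the direction of differentiation. -/
theorem nablaEnd_readEnd_complexLinear (hg : IsPseudoRiemannianMetric g) {A : EndField E X}
    (hA : A.IsSmooth) (hAA : ∀ y, A y * A y = -1) (Ω : SymplecticForm E X)
    (hΩ : ∀ y, Ω.form y = g y ∘L A y) (x : X) (u : E) :
    nablaEnd (christoffelAt g x) (readEnd x A) (chartPt x) (readEnd x A (chartPt x) u) =
      nablaEnd (christoffelAt g x) (readEnd x A) (chartPt x) u * readEnd x A (chartPt x) := by
  have : CompleteSpace E := FiniteDimensional.complete ℝ E
  have hread : ∀ᶠ z in nhds (chartPt x),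
      readBil x g z ∘L readEnd x A z = readBil x Ω.form z := by
    filter_upwards [eventually_chartInv_mem x] with z hz
    rw [readBil, readBil, hΩ]
    exact (coordBil_comp hz _ _).symm
  have hskew : ∀ᶠ z in nhds (chartPt x), ∀ v w,
      readBil x g z (readEnd x A z v) w = -readBil x g z (readEnd x A z w) v := by
    filter_upwards [hread] with z hz v w
    have h (v w : E) : readBil x g z (readEnd x A z v) w = readBil x Ω.form z v w :=
      congr($hz v w)
    rw [h, h]
    exact Ω.skew _ _ _
  refine nablaEnd_complexLinear (differentiableAt_readBil hg.smooth x)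
    (differentiableAt_readEnd hA x) (christoffelAt_symm hg x)
    (isInvertible_readBil hg.nondegenerate x).injective (christoffelAt_metric hg x)
    (eventually_readEnd_mul_self hAA x) hskew (fun v w ↦ ?_) (fun u v w ↦ ?_) u
  · rw [hskew.self_of_nhds, readBil_symm hg]
  · rw [Filter.EventuallyEq.fderiv_eq hread]
    exact fderiv_readBil_cyclic Ω.smooth Ω.alternating Ω.closed x u v w

/-- Three symplectic forms which are the fundamental forms of almost complex structures with the
quaternion relations, for a common metric, have parallel almost complex structures. -/
theorem isParallel_combination (hg : IsPseudoRiemannianMetric g) {I J K : EndField E X}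
    (hI : I.IsSmooth) (hJ : J.IsSmooth) (hK : K.IsSmooth)
    (hII : ∀ y, I y * I y = -1) (hJJ : ∀ y, J y * J y = -1) (hKK : ∀ y, K y * K y = -1)
    (hIJ : ∀ y, I y * J y = K y) (hJI : ∀ y, J y * I y = -K y) (Ω₁ Ω₂ Ω₃ : SymplecticForm E X)
    (hΩ₁ : ∀ y, Ω₁.form y = g y ∘L I y) (hΩ₂ : ∀ y, Ω₂.form y = g y ∘L J y)
    (hΩ₃ : ∀ y, Ω₃.form y = g y ∘L K y) (a b c d : ℝ) :
    (combination I J K a b c d).IsParallel (leviCivita g) := by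
  refine isParallel_leviCivita (hI.combination hJ hK a b c d) fun x u ↦ ?_
  have hJI' : ∀ᶠ z in nhds (chartPt x), readEnd x J z * readEnd x I z = -readEnd x K z := by
    filter_upwards [eventually_readEnd_mul (C := fun y ↦ -K y) hJI x] with z hz
    rw [hz, readEnd, coordEnd_neg, readEnd]
  obtain ⟨h₁, h₂, h₃⟩ := nablaEnd_eq_zero (Γ := christoffelAt g x) (differentiableAt_readEnd hI x)
    (differentiableAt_readEnd hJ x) (eventually_readEnd_mul_self hII x)
    (eventually_readEnd_mul_self hJJ x) (eventually_readEnd_mul hIJ x) hJI'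
    (nablaEnd_readEnd_complexLinear hg hI hII Ω₁ hΩ₁ x)
    (nablaEnd_readEnd_complexLinear hg hJ hJJ Ω₂ hΩ₂ x)
    (nablaEnd_readEnd_complexLinear hg hK hKK Ω₃ hΩ₃ x) u
  rw [nablaEnd_readEnd_combination hI hJ hK, h₁, h₂, h₃]
  simp

end Parallel

/-! ### Assembly of the pseudo-hyper-Kähler structure. -/

section Triple

variable {E : Type*} [NormedAddCommGroup E] [NormedSpace ℝ E] [FiniteDimensional ℝ E]
  {X : Type*} [TopologicalSpace X] [ChartedSpace E X] [IsManifold 𝓘(ℝ, E) ∞ X]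
  {Ω₁ Ω₂ Ω₃ : SymplecticForm E X}

theorem isPseudoRiemannianMetric_tripleComp (h₁₂ : invComp Ω₁ Ω₂ = -invComp Ω₂ Ω₁)
    (h₂₃ : invComp Ω₂ Ω₃ = -invComp Ω₃ Ω₂) (h₃₁ : invComp Ω₃ Ω₁ = -invComp Ω₁ Ω₃) :
    IsPseudoRiemannianMetric (tripleComp Ω₁ Ω₂ Ω₃) where
  smooth := Ω₁.smooth.comp (isSmooth_invComp Ω₂ Ω₃)
  symm := tripleComp_symm h₁₂ h₂₃ h₃₁
  nondegenerate := tripleComp_nondegenerate h₂₃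

/-- The action of the quaternions on `TX` for which `i`, `j`, `k` act as `-Ω₂⁻¹ ∘ Ω₃`,
`-Ω₃⁻¹ ∘ Ω₁`, `-Ω₁⁻¹ ∘ Ω₂`. -/
def quaternionAction (h₁₂ : invComp Ω₁ Ω₂ = -invComp Ω₂ Ω₁)
    (h₂₃ : invComp Ω₂ Ω₃ = -invComp Ω₃ Ω₂) (h₃₁ : invComp Ω₃ Ω₁ = -invComp Ω₁ Ω₃) :
    QuaternionAction E X :=
  fun x ↦ (quaternionBasis h₁₂ h₂₃ h₃₁ x).liftHom

theorem quaternionAction_apply (h₁₂ : invComp Ω₁ Ω₂ = -invComp Ω₂ Ω₁)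
    (h₂₃ : invComp Ω₂ Ω₃ = -invComp Ω₃ Ω₂) (h₃₁ : invComp Ω₃ Ω₁ = -invComp Ω₁ Ω₃) (x : X)
    (q : ℍ[ℝ]) : quaternionAction h₁₂ h₂₃ h₃₁ x q =
      combination (fun x ↦ -invComp Ω₂ Ω₃ x) (fun x ↦ -invComp Ω₃ Ω₁ x)
        (fun x ↦ -invComp Ω₁ Ω₂ x) q.re q.imI q.imJ q.imK x := by
  rw [combination, ← Algebra.algebraMap_eq_smul_one]
  rfl

theorem isPseudoHyperKahler_tripleComp (h₁₂ : invComp Ω₁ Ω₂ = -invComp Ω₂ Ω₁)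
    (h₂₃ : invComp Ω₂ Ω₃ = -invComp Ω₃ Ω₂) (h₃₁ : invComp Ω₃ Ω₁ = -invComp Ω₁ Ω₃) :
    IsPseudoHyperKahler (tripleComp Ω₁ Ω₂ Ω₃) (quaternionAction h₁₂ h₂₃ h₃₁) := by
  have hg := isPseudoRiemannianMetric_tripleComp h₁₂ h₂₃ h₃₁
  have hI := (isSmooth_invComp Ω₂ Ω₃).neg
  have hJ := (isSmooth_invComp Ω₃ Ω₁).neg
  have hK := (isSmooth_invComp Ω₁ Ω₂).neg
  have hΩ₁ := form_eq_tripleComp_comp₁ (Ω₁ := Ω₁) h₂₃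
  have hΩ₂ := form_eq_tripleComp_comp₂ h₁₂ h₂₃
  have hΩ₃ := form_eq_tripleComp_comp₃ h₁₂ h₂₃ h₃₁
  refine ⟨hg, fun q ↦ ?_, fun q x v w ↦ ?_, leviCivita (tripleComp Ω₁ Ω₂ Ω₃),
    isLeviCivita_leviCivita hg, fun q ↦ ?_⟩
  · simp only [quaternionAction_apply]
    exact hI.combination hJ hK _ _ _ _
  -- Since `gA` is a skew form and `g` is symmetric, `A` is `g`-skew. The adjoint thus negates the
  -- three imaginary coefficients, as conjugation does.
  · have key {Ω : SymplecticForm E X} {A : EndField E X}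
        (h : ∀ x, Ω.form x = tripleComp Ω₁ Ω₂ Ω₃ x ∘L A x) :
        tripleComp Ω₁ Ω₂ Ω₃ x (A x v) w = -tripleComp Ω₁ Ω₂ Ω₃ x v (A x w) := by
      have h' (v w : TangentSpace 𝓘(ℝ, E) x) :
        tripleComp Ω₁ Ω₂ Ω₃ x (A x v) w = Ω.form x v w := congr($(h x) v w).symm
      rw [h', hg.symm x v, h', Ω.skew]
    rw [quaternionAction_apply, quaternionAction_apply]
    simp only [combination, add_apply, smul_apply, map_add, map_smul, smul_eq_mul, key hΩ₁,
      key hΩ₂, key hΩ₃, one_apply_eq_self, Quaternion.re_star, Quaternion.imI_star, Quaternion.imJ_star,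
      Quaternion.imK_star]
    ring
  · simp only [quaternionAction_apply]
    exact isParallel_combination hg hI hJ hK
      (fun x ↦ (neg_mul_neg _ _).trans (invComp_mul_self h₂₃ x))
      (fun x ↦ (neg_mul_neg _ _).trans (invComp_mul_self h₃₁ x))
      (fun x ↦ (neg_mul_neg _ _).trans (invComp_mul_self h₁₂ x))
      (fun x ↦ (quaternionBasis h₁₂ h₂₃ h₃₁ x).i_mul_j)
      (fun x ↦ (neg_mul_neg _ _).trans ((invComp_mul_invComp h₂₃ h₃₁ x).trans (neg_neg _).symm))
      Ω₁ Ω₂ Ω₃ hΩ₁ hΩ₂ hΩ₃ _ _ _ _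

end Triple

end HyperKahler

end

theorem proposition2p1
    {E : Type*} [NormedAddCommGroup E] [NormedSpace ℝ E] [FiniteDimensional ℝ E]
    {X : Type*} [TopologicalSpace X] [ChartedSpace E X] [IsManifold 𝓘(ℝ, E) ∞ X]
    (ωI ωJ ωK : HyperKahler.SymplecticForm E X)
    (hIJ : HyperKahler.invComp ωI ωJ = -HyperKahler.invComp ωJ ωI)
    (hJK : HyperKahler.invComp ωJ ωK = -HyperKahler.invComp ωK ωJ)
    (hKI : HyperKahler.invComp ωK ωI = -HyperKahler.invComp ωI ωK) :
    HyperKahler.IsPseudoRiemannianMetric (HyperKahler.tripleComp ωI ωJ ωK) ∧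
    ∃ ρ : HyperKahler.QuaternionAction E X,
      ωI.form = HyperKahler.kahlerForm (HyperKahler.tripleComp ωI ωJ ωK) ρ ⟨0, 1, 0, 0⟩ ∧
      ωJ.form = HyperKahler.kahlerForm (HyperKahler.tripleComp ωI ωJ ωK) ρ ⟨0, 0, 1, 0⟩ ∧
      ωK.form = HyperKahler.kahlerForm (HyperKahler.tripleComp ωI ωJ ωK) ρ ⟨0, 0, 0, 1⟩ ∧
      HyperKahler.IsPseudoHyperKahler (HyperKahler.tripleComp ωI ωJ ωK) ρ ∧
      (HyperKahler.IsPositiveDefinite (HyperKahler.tripleComp ωI ωJ ωK) →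
        HyperKahler.IsHyperKahler (HyperKahler.tripleComp ωI ωJ ωK) ρ) := by
  have hmain := HyperKahler.isPseudoHyperKahler_tripleComp hIJ hJK hKI
  refine ⟨hmain.metric, HyperKahler.quaternionAction hIJ hJK hKI, ?_, ?_, ?_, hmain,
    fun h ↦ ⟨hmain, h⟩⟩
  · funext x
    refine (HyperKahler.form_eq_tripleComp_comp₁ hJK x).trans
      (congrArg (HyperKahler.tripleComp ωI ωJ ωK x).comp ?_)
    refine Eq.trans ?_ (HyperKahler.quaternionAction_apply hIJ hJK hKI x ⟨0, 1, 0, 0⟩).symm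
    simp [HyperKahler.combination]
  · funext x
    refine (HyperKahler.form_eq_tripleComp_comp₂ hIJ hJK x).trans
      (congrArg (HyperKahler.tripleComp ωI ωJ ωK x).comp ?_)
    refine Eq.trans ?_ (HyperKahler.quaternionAction_apply hIJ hJK hKI x ⟨0, 0, 1, 0⟩).symm
    simp [HyperKahler.combination]
  · funext x
    refine (HyperKahler.form_eq_tripleComp_comp₃ hIJ hJK hKI x).trans
      (congrArg (HyperKahler.tripleComp ωI ωJ ωK x).comp ?_)
    refine Eq.trans ?_ (HyperKahler.quaternionAction_apply hIJ hJK hKI x ⟨0, 0, 0, 1⟩).symm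
    simp [HyperKahler.combination]
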